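/- **Setting.** Let $K,N\ge 2$ be integers and $[a:b]=\{a,\dots,b\}$ (empty if $a>b$). An $(N,K)$ private information retrieval code has $K$ mutually independent messages $W_1,\dots,W_K$, each of $L\ge1$ i.i.d. uniform symbols from a finite alphabet $\mathcal X$, $|\mathcal X|\ge 2$. Server $n\in[1:N]$ stores $S_n\in\mathcal S_n$ ($\mathcal S_n$ finite), a function of $W_{1:K}$. A discrete random key $\mathbf F$, independent of $W_{1:K}$, determines the queries $Q_n^{[k]}$, $n\in[1:N]$, $k\in[1:K]$. The answer $A_n^{[k]}$ of server $n$ is obtained from $(Q_n^{[k]},S_n)$ by a map that does not depend on $k$; it is a string over a finite alphabet $\mathcal Y$ whose length $\ell_n$ is determined by the query. For every $k$, $W_k$ is a function of $(A_{1:N}^{[k]},Q_{1:N}^{[k]})$ with probability one (correctness), and for each server $n$ the distribution of $Q_n^{[k]}$ does not depend on $k$ (privacy). Logarithms and entropies are to the base $|\mathcal X|$. The operational costs of the code are $$\bar\alpha=\frac1{NL}\sum_{n=1}^N\log|\mathcal S_n|,\qquad \bar\beta=\frac{\log|\mathcal Y|}{NL}\sum_{n=1}^N\mathbb E(\ell_n),$$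 and its informational costs are $\frac1{NL}\sum_n H(S_n)$ and $\frac1{NL}\sum_n H(A_n^{[k]}\mid Q_{1:N}^{[k]})$; the download costs do not depend on $k$. A pair $(\alpha,\beta)$ is achievable if some code has storage cost at most $\alpha$ and (finite) download cost at most $\beta$. For $m\in[1:N]$ let $$B_N(K,m)=\inf_{\text{achievable }(\alpha,\beta)}\{(N-m)\alpha+m\beta\}.$$ There are two versions of $B_N(K,m)$, one for the operational and one for the informational costs. **Coefficients.** For $m\in[2:N-1]$ let $\mathbb C_m$ be the set of real vectors $\boldsymbol c=(c_j^n: j\in[1:m],\,n\in[0:N-j+1])$ such that $0\le c_j^n\le 1$ for all $j,n$, $\sum_{n=0}^{N-j+1}c_j^n=1$ for every $j\in[1:m]$, and $$\sum_{i=j}^N(N-i+1)d_i\ \ge\ \sum_{i=j}^m(N-i+1)\quad\text{for all } j\in[2:m],$$ where $$d_j=\begin{cases}\sum_{i=2}^{j-1}c_i^{j-i}\left(\frac1{j-i}-\frac1{j-1}\right)+c_{j-1}^0+\sum_{n=1}^{N-j+1}\frac{(n-1)c_j^n}{n},& j\in[2:m],\\ c_m^0+\sum_{i=2}^{m}c_i^{j-i}\left(\frac1{j-i}-\frac1{j-1}\right),&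 j=m+1,\\ \sum_{i=2}^{m}c_i^{j-i}\left(\frac1{j-i}-\frac1{j-1}\right),& j\in[m+2:N].\end{cases}$$ Let $\mathbb C$ be the set of all families $\boldsymbol c=(\boldsymbol c(k,m'))_{k\in[2:K],\,m'\in[2:N-1]}$ with $\boldsymbol c(k,m')\in\mathbb C_{m'}$. **Recursion.** For $\boldsymbol c\in\mathbb C$ put $\widetilde{B_N}(1,m,\boldsymbol c)=1$ for $m\in[1:N]$, and for $k\in[2:K]$ put $\widetilde{B_N}(k,1,\boldsymbol c)=k$, $\widetilde{B_N}(k,N,\boldsymbol c)=N\left(\frac1N+\frac1{N^2}+\dots+\frac1{N^k}\right)$, and, for $m\in[2:N-1]$, with $c_j^n$ the entries of $\boldsymbol c(k,m)$, $$\widetilde{B_N}(k,m,\boldsymbol c)=1+c_1^1(k-1)+\sum_{j=2}^m\sum_{n=1}^{N-j+1}\frac{c_j^n}{j+n-1}\,\widetilde{B_N}(k-1,j+n-1,\boldsymbol c).$$ **Theorem.** For all $K\ge2$, $N\ge2$ and $m\in[1:N]$, the maximum $\underline{B_N}(K,m)=\max_{\boldsymbol c\in\mathbb C}\widetilde{B_N}(K,m,\boldsymbol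 c)$ exists, and $$B_N(K,m)\ \ge\ \underline{B_N}(K,m)\ \ge\ \widetilde{B_N}(K,m,\boldsymbol c)\qquad\text{for all }\boldsymbol c\in\mathbb C,$$ for the informational and for the operational version of $B_N(K,m)$. -/

import Mathlib

namespace PIR

open Finset

noncomputable section

/-- Shannon entropy (in nats) of the discrete random variable `X` on the discrete probability
space `(Ω, p)`. -/
def entropy {Ω α : Type} (p : PMF Ω) (X : Ω → α) : ℝ :=
  ∑' x, Real.negMulLog ((p.map X) x).toReal

/-- Conditional Shannon entropy `H(X | Y) = ∑ p(x, y) log (p(y) / p(x, y))` (in nats). -/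
def condEntropy {Ω α β : Type} (p : PMF Ω) (X : Ω → α) (Y : Ω → β) : ℝ :=
  ∑' z : α × β, ((p.map fun ω => (X ω, Y ω)) z).toReal *
    Real.log (((p.map Y) z.2).toReal / ((p.map fun ω => (X ω, Y ω)) z).toReal)

/-- A private information retrieval code with `N` servers and `K` messages. -/
structure Code (N K : ℕ) where
  /-- the alphabet of the message symbols -/
  X : Type
  [fintypeX : Fintype X]
  [nontrivialX : Nontrivial X]
  /-- the number of symbols of each message -/
  L : ℕ
  L_pos : 0 < L
  /-- the alphabet of the content stored at server `n` -/
  S : Fin N → Type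
  [fintypeS : ∀ n, Fintype (S n)]
  /-- the content of server `n` as a function of all the messages -/
  store : ∀ n, (Fin K → Fin L → X) → S n
  /-- the values of the random key, and the law of the key -/
  F : Type
  key : PMF F
  /-- the query alphabet of server `n` -/
  Q : Fin N → Type
  /-- the query sent to server `n` when message `k` is requested, as a function of the key -/
  query : Fin K → ∀ n, F → Q n
  /-- the alphabet of the answer symbols -/
  Y : Type
  [fintypeY : Fintype Y]
  /-- the number of symbols in the answer of server `n` to a given query -/
  len : ∀ n, Q n → ℕ
  /-- the answer of server `n`, which sees only the query and its stored content -/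
  answer : ∀ n, Q n → S n → List Y
  length_answer : ∀ n q s, (answer n q s).length = len n q
  /-- reconstruction of message `k` from all the answers and all the queries -/
  decode : Fin K → (Fin N → List Y) → (∀ n, Q n) → Fin L → X
  correct : ∀ k, ∀ f ∈ key.support, ∀ w : Fin K → Fin L → X,
    decode k (fun n => answer n (query k n f) (store n w)) (fun n => query k n f) = w k
  /-- the law of the query to any one server does not depend on the requested message -/
  privacy : ∀ n k k', key.map (query k n) = key.map (query k' n)

attribute [instance] Code.fintypeX Code.nontrivialX Code.fintypeS Code.fintypeY

namespace Code

variable {N K : ℕ} (C : Code N K)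

/-- All the messages. -/
abbrev Msg : Type := Fin K → Fin C.L → C.X

/-- The joint law of messages and key: the `K * L` message symbols are i.i.d. uniform, and the key
is independent of them. -/
def law : PMF (C.Msg × C.F) :=
  (PMF.uniformOfFintype C.Msg).bind fun w => C.key.map fun f => (w, f)

/-- The stored content `S_n` as a random variable. -/
def stored (n : Fin N) (ω : C.Msg × C.F) : C.S n := C.store n ω.1

/-- The collection `Q_{1:N}^{[k]}` of all the queries as a random variable. -/
def queries (k : Fin K) (ω : C.Msg × C.F) : ∀ n, C.Q n := fun n => C.query k n ω.2

/-- The answer `A_n^{[k]}` as a random variable. -/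
def ans (k : Fin K) (n : Fin N) (ω : C.Msg × C.F) : List C.Y :=
  C.answer n (C.query k n ω.2) (C.store n ω.1)

/-- Operational normalized average storage cost. -/
def opStorage : ℝ :=
  1 / ((N : ℝ) * C.L) * ∑ n, Real.logb (Fintype.card C.X) (Fintype.card (C.S n))

/-- Expected length of the answer of server `n` when message `k` is requested (meaningful when
`FiniteLength` holds). -/
def expLength (k : Fin K) (n : Fin N) : ℝ :=
  ∑' f, (C.key f).toReal * (C.len n (C.query k n f) : ℝ)

/-- All the answers have finite expected length. -/
def FiniteLength : Prop :=
  ∀ k n, Summable fun f => (C.key f).toReal * (C.len n (C.query k n f) : ℝ)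

/-- Operational normalized average download cost when message `k` is requested. -/
def opDownload (k : Fin K) : ℝ :=
  Real.logb (Fintype.card C.X) (Fintype.card C.Y) / ((N : ℝ) * C.L) * ∑ n, C.expLength k n

/-- Informational normalized average storage cost; the division by `log |X|` makes `|X|` the base
of the logarithms. -/
def infoStorage : ℝ :=
  1 / ((N : ℝ) * C.L) * ∑ n, entropy C.law (C.stored n) / Real.log (Fintype.card C.X)

/-- Informational normalized average download cost when message `k` is requested. -/
def infoDownload (k : Fin K) : ℝ :=
  1 / ((N : ℝ) * C.L) *
    ∑ n, condEntropy C.law (C.ans k n) (C.queries k) / Real.log (Fintype.card C.X)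

end Code

/-- `(α, β)` is achievable with respect to the operational costs. -/
def OpAchievable (N K : ℕ) (α β : ℝ) : Prop :=
  ∃ C : Code N K, C.FiniteLength ∧ C.opStorage ≤ α ∧ ∀ k, C.opDownload k ≤ β

/-- `(α, β)` is achievable with respect to the informational costs. -/
def InfoAchievable (N K : ℕ) (α β : ℝ) : Prop :=
  ∃ C : Code N K, C.infoStorage ≤ α ∧ ∀ k, C.infoDownload k ≤ β

/-- `B_N(K, m)` for the operational costs. -/
def opB (N K m : ℕ) : ℝ :=
  sInf {x | ∃ α β, OpAchievable N K α β ∧ x = ((N : ℝ) - m) * α + m * β}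

/-- `B_N(K, m)` for the informational costs. -/
def infoB (N K m : ℕ) : ℝ :=
  sInf {x | ∃ α β, InfoAchievable N K α β ∧ x = ((N : ℝ) - m) * α + m * β}

/-- The numbers `d_j`, `j ∈ [2:N]`, attached to coefficients `c j n = c_j^n`. -/
def dCoeff (N m : ℕ) (c : ℕ → ℕ → ℝ) (j : ℕ) : ℝ :=
  if j ≤ m then
    ∑ i ∈ Icc 2 (j - 1), c i (j - i) * (1 / ((j : ℝ) - i) - 1 / ((j : ℝ) - 1)) + c (j - 1) 0
      + ∑ n ∈ Icc 1 (N + 1 - j), ((n : ℝ) - 1) * c j n / n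
  else if j = m + 1 then
    c m 0 + ∑ i ∈ Icc 2 m, c i (j - i) * (1 / ((j : ℝ) - i) - 1 / ((j : ℝ) - 1))
  else
    ∑ i ∈ Icc 2 m, c i (j - i) * (1 / ((j : ℝ) - i) - 1 / ((j : ℝ) - 1))

/-- The coefficient vectors `(c_j^n : j ∈ [1:m], n ∈ [0:N-j+1])`, extended by zero to all `j, n`,
that are admissible for the parameter `m`. -/
structure IsAdmissible (N m : ℕ) (c : ℕ → ℕ → ℝ) : Prop where
  eq_zero : ∀ j n, ¬ (j ∈ Icc 1 m ∧ n ≤ N + 1 - j) → c j n = 0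
  sum_eq_one : ∀ j ∈ Icc 1 m, ∑ n ∈ Icc 0 (N + 1 - j), c j n = 1
  mem_unit : ∀ j ∈ Icc 1 m, ∀ n ∈ Icc 0 (N + 1 - j), 0 ≤ c j n ∧ c j n ≤ 1
  subset_entropy : ∀ j ∈ Icc 2 m,
    ∑ i ∈ Icc j m, ((N : ℝ) - i + 1) ≤ ∑ i ∈ Icc j N, ((N : ℝ) - i + 1) * dCoeff N m c i

/-- The coefficients that drive the recursion: an admissible vector `c k m` for every pair `(k, m)`
at which the recursive step can be taken. -/
def Coeffs (N K : ℕ) : Set (ℕ → ℕ → ℕ → ℕ → ℝ) :=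
  {c | ∀ k ∈ Icc 2 K, ∀ m ∈ Icc 2 (N - 1), IsAdmissible N m (c k m)}

/-- `β₀ = 1/N + 1/N² + ⋯ + 1/N^K`. -/
def beta0 (N K : ℕ) : ℝ := ∑ i ∈ Icc 1 K, 1 / (N : ℝ) ^ i

/-- The recursively defined bound; the arguments after `c` are the number `K` of messages and the
parameter `m` (the value at `K = 0` is irrelevant). -/
def tildeB (N : ℕ) (c : ℕ → ℕ → ℕ → ℕ → ℝ) : ℕ → ℕ → ℝ
  | 0, _ => 0
  | 1, _ => 1
  | K + 2, m =>
    if m = 1 then ((K + 2 : ℕ) : ℝ)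
    else if m = N then N * beta0 N (K + 2)
    else 1 + c (K + 2) m 1 1 * (((K + 2 : ℕ) : ℝ) - 1)
      + ∑ j ∈ Icc 2 m, ∑ n ∈ Icc 1 (N + 1 - j),
          c (K + 2) m j n / ((j : ℝ) + n - 1) * tildeB N c (K + 1) (j + n - 1)

/-- The supremum of the recursively defined bound over all the admissible coefficients. -/
def underB (N K m : ℕ) : ℝ := sSup ((fun c => tildeB N c K m) '' Coeffs N K)

end

end PIR

/-! For a code with desired message `k`, consider the entropy, conditioned on the key and on the
first `t` messages, of the answers of some servers together with the contents of others. Averaged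
over all permutations of the servers and measured in units of one message, these entropies become
numbers `g a b`, for `a` answers and `b` contents of distinct servers (`Code.condProfile`). Three
facts are used. Entropy is monotone and submodular, even on the lattice of levels nothing < answer <
content, because a content determines the answer. By correctness, for `a + b = N` moving message `k`
into the conditioning costs at least one unit (`Code.condProfile_decode`). By privacy, `g a b` with
`a ≤ 1` does not depend on the desired message (`Code.condProfile_privacy`).

The bound follows by induction on the number of messages (`Code.tildeB_le_condProfile`). After one
message is decoded, the chain rule bounds `g m (N - m)` below by `∑ g 1 (N - j)`, `j ∈ [1:m]`, minus
`∑ g 0 (N + 1 - i)`, `i ∈ [2:m]`; these terms contain at most one answer, so `g` may be replaced by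
the profile `g'` of the next message. For `j ≥ 2`, the `c_j^n` average lower bounds for `g' 1 (N -
j)`: `g' 0 (N - j)` for `n = 0`, and `IsProfile.window` for `n ≥ 1`; for `j = 1` only `n ∈ {0, 1}`
is kept. The content-only terms so obtained have total weights `d_i`, and the constraints on `c`,
combined with Han's inequality, say that they cover the subtracted sum
(`IsAdmissible.sum_stored_le`). What is left is the recursion (`IsAdmissible.recursion`); `m = 1`
and `m = N` are treated directly.

Finally, subadditivity bounds `g m (N - m)` by the weighted costs, and informational costs are at
most operational ones. The maximum exists since `tildeB` is continuous in `c` and depends only on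
coefficients ranging over a compact set. -/

namespace PIR

open Finset

noncomputable section

/-! ### Entropy of partitions of a finite set under the uniform law -/

open Classical in
/-- The equivalence class of `w`, as a finset. -/
def cls {M : Type} [Fintype M] (r : Setoid M) (w : M) : Finset M := univ.filter fun v => r w v

lemma mem_cls {M : Type} [Fintype M] {r : Setoid M} {w v : M} : v ∈ cls r w ↔ r w v := by
  simp [cls]

lemma self_mem_cls {M : Type} [Fintype M] (r : Setoid M) (w : M) : w ∈ cls r w :=
  mem_cls.2 (r.refl w)

lemma card_cls_pos {M : Type} [Fintype M] (r : Setoid M) (w : M) : 0 < ((cls r w).card : ℝ) := by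
  exact_mod_cast Finset.card_pos.2 ⟨w, self_mem_cls r w⟩

lemma cls_eq {M : Type} [Fintype M] {r : Setoid M} {w v : M} (h : r w v) : cls r w = cls r v := by
  ext x
  rw [mem_cls, mem_cls]
  exact ⟨fun hx => r.trans (r.symm h) hx, fun hx => r.trans h hx⟩

/-- Entropy (in nats) of the partition of a finite set `M` into the classes of `r`, for the uniform
law on `M`. -/
def unifEntropy {M : Type} [Fintype M] (r : Setoid M) : ℝ :=
  (∑ w, (Real.log (Fintype.card M) - Real.log (cls r w).card)) / Fintype.card M

section

variable {M : Type} [Fintype M]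

lemma log_card_cls_le (r : Setoid M) (w : M) :
    Real.log (cls r w).card ≤ Real.log (Fintype.card M) :=
  Real.log_le_log (card_cls_pos r w) (by exact_mod_cast Finset.card_le_univ _)

lemma unifEntropy_nonneg (r : Setoid M) : 0 ≤ unifEntropy r :=
  div_nonneg (Finset.sum_nonneg fun w _ => sub_nonneg.2 (log_card_cls_le r w)) (Nat.cast_nonneg _)

/-- In the order of `Setoid`, smaller means finer, hence more informative. -/
lemma unifEntropy_anti {r s : Setoid M} (h : r ≤ s) : unifEntropy s ≤ unifEntropy r := by
  unfold unifEntropy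
  gcongr with w
  · exact card_cls_pos r w
  · intro v hv
    exact mem_cls.2 (h (mem_cls.1 hv))

/-- Up to the factor `Fintype.card M`, the left side is the mass that the coupling of `r` and `s`,
conditionally independent given `t`, puts on the nonempty classes of `r ⊓ s`; so it is at most `1`.
-/
lemma sum_card_ratio_le {r s t : Setoid M} (hr : r ≤ t) (hs : s ≤ t) :
    ∑ w, ((cls r w).card * (cls s w).card / ((cls (r ⊓ s) w).card * (cls t w).card) : ℝ) ≤
      Fintype.card M := by
  classical
  -- For fixed `u` and `v` the `w` that contribute form a single class of `r ⊓ s`, or none; if there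
  -- is one, then `t u v`.
  have key : ∀ u v : M, ∑ w, (if r w u ∧ s w v then
      (1 / ((cls (r ⊓ s) w).card * (cls t w).card) : ℝ) else 0) ≤
      if t u v then 1 / ((cls t u).card : ℝ) else 0 := by
    intro u v
    by_cases hne : ∃ w, r w u ∧ s w v
    · obtain ⟨w₀, h1, h2⟩ := hne
      have htuv : t u v := t.trans (t.symm (hr h1)) (hs h2)
      rw [if_pos htuv, ← Finset.sum_filter]
      have hset : (univ.filter fun w => r w u ∧ s w v) = cls (r ⊓ s) w₀ := by
        ext w
        simp only [mem_filter, mem_univ, true_and, mem_cls]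
        exact ⟨fun ⟨a, b⟩ => ⟨r.trans h1 (r.symm a), s.trans h2 (s.symm b)⟩,
          fun ⟨a, b⟩ => ⟨r.trans (r.symm a) h1, s.trans (s.symm b) h2⟩⟩
      rw [hset]
      have : ∀ w ∈ cls (r ⊓ s) w₀,
          (1 / ((cls (r ⊓ s) w).card * (cls t w).card) : ℝ) =
          1 / ((cls (r ⊓ s) w₀).card * (cls t u).card) := by
        intro w hw
        have hw' := mem_cls.1 hw
        rw [← cls_eq hw', ← cls_eq (t.trans (t.symm (hr h1)) (hr hw'.1))]
      rw [Finset.sum_congr rfl this, Finset.sum_const, nsmul_eq_mul]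
      have hp := card_cls_pos (r ⊓ s) w₀
      have hq := card_cls_pos t u
      apply le_of_eq
      field_simp
    · push Not at hne
      rw [Finset.sum_eq_zero]
      · split_ifs <;> positivity
      · intro w _
        rw [if_neg]
        exact fun h => hne w h.1 h.2
  calc ∑ w, ((cls r w).card * (cls s w).card / ((cls (r ⊓ s) w).card * (cls t w).card) : ℝ)
      = ∑ w, ∑ u, ∑ v, (if r w u ∧ s w v then
          (1 / ((cls (r ⊓ s) w).card * (cls t w).card) : ℝ) else 0) := by
        refine Finset.sum_congr rfl fun w _ => ?_
        have h1 : ∀ q : Setoid M, ((cls q w).card : ℝ) = ∑ u, if q w u then 1 else 0 := by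
          intro q
          rw [Finset.sum_boole]
          congr
        rw [h1 r, h1 s, Finset.sum_mul_sum, Finset.sum_div]
        refine Finset.sum_congr rfl fun u _ => ?_
        rw [Finset.sum_div]
        refine Finset.sum_congr rfl fun v _ => ?_
        by_cases a : r w u <;> by_cases b : s w v <;> simp [a, b]
    _ = ∑ u, ∑ v, ∑ w, (if r w u ∧ s w v then
          (1 / ((cls (r ⊓ s) w).card * (cls t w).card) : ℝ) else 0) := by
        rw [Finset.sum_comm]
        exact Finset.sum_congr rfl fun u _ => Finset.sum_comm
    _ ≤ ∑ u, ∑ v, if t u v then 1 / ((cls t u).card : ℝ) else 0 :=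
        Finset.sum_le_sum fun u _ => Finset.sum_le_sum fun v _ => key u v
    _ = ∑ _u : M, (1 : ℝ) := by
        refine Finset.sum_congr rfl fun u _ => ?_
        rw [← Finset.sum_filter, Finset.sum_const, nsmul_eq_mul]
        have hq := card_cls_pos t u
        have : (univ.filter fun v => t u v) = cls t u := by ext v; simp [mem_cls]
        rw [this]
        field_simp
    _ = Fintype.card M := by simp

/-- Nonnegativity of conditional mutual information, from `log x ≤ x - 1` at the ratio of
`sum_card_ratio_le`. It suffices that `t` is coarser than both relations; it need not be their join.
-/
lemma unifEntropy_submodular {r s t : Setoid M} (hr : r ≤ t) (hs : s ≤ t) :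
    unifEntropy (r ⊓ s) + unifEntropy t ≤ unifEntropy r + unifEntropy s := by
  unfold unifEntropy
  rw [← add_div, ← add_div, ← Finset.sum_add_distrib, ← Finset.sum_add_distrib]
  refine div_le_div_of_nonneg_right ?_ (Nat.cast_nonneg _)
  rw [← sub_nonneg, ← Finset.sum_sub_distrib, ← neg_nonpos, ← Finset.sum_neg_distrib]
  have h : ∀ w ∈ (univ : Finset M),
      -(Real.log (Fintype.card M) - Real.log (cls r w).card +
        (Real.log (Fintype.card M) - Real.log (cls s w).card) -
        (Real.log (Fintype.card M) - Real.log (cls (r ⊓ s) w).card +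
        (Real.log (Fintype.card M) - Real.log (cls t w).card))) ≤
      ((cls r w).card * (cls s w).card / ((cls (r ⊓ s) w).card * (cls t w).card) : ℝ) - 1 := by
    intro w _
    have h1 := card_cls_pos r w
    have h2 := card_cls_pos s w
    have h3 := card_cls_pos t w
    have h4 := card_cls_pos (r ⊓ s) w
    have := Real.log_le_sub_one_of_pos (div_pos (mul_pos h1 h2) (mul_pos h4 h3))
    rw [Real.log_div (by positivity) (by positivity), Real.log_mul h1.ne' h2.ne',
      Real.log_mul h4.ne' h3.ne'] at this
    linarith
  refine (Finset.sum_le_sum h).trans ?_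
  rw [Finset.sum_sub_distrib]
  have := sum_card_ratio_le hr hs
  simp only [Finset.sum_const, Finset.card_univ, nsmul_eq_mul, mul_one]
  linarith

lemma unifEntropy_le_log_card (r : Setoid M) :
    unifEntropy r ≤ Real.log (Fintype.card M) := by
  unfold unifEntropy
  have h : ∀ w ∈ (univ : Finset M), Real.log (Fintype.card M) - Real.log (cls r w).card ≤
      Real.log (Fintype.card M) := fun w _ => by
    have : (0 : ℝ) ≤ Real.log (cls r w).card := Real.log_natCast_nonneg _
    linarith
  refine (div_le_div_of_nonneg_right (Finset.sum_le_sum h) (Nat.cast_nonneg _)).trans ?_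
  rcases Nat.eq_zero_or_pos (Fintype.card M) with h0 | h0
  · simp [h0]
  · have : (0 : ℝ) < Fintype.card M := by exact_mod_cast h0
    simp only [Finset.sum_const, Finset.card_univ, nsmul_eq_mul]
    apply le_of_eq
    field_simp

lemma sum_inv_card_cls_le {α : Type} (X : M → α) (T : Finset α) (hT : ∀ w, X w ∈ T) :
    ∑ w, (1 / (cls (Setoid.ker X) w).card : ℝ) ≤ T.card := by
  classical
  rw [← Finset.sum_fiberwise_of_maps_to (s := univ) (t := T) (g := X) fun w _ => hT w]
  calc _ ≤ ∑ _x ∈ T, (1 : ℝ) := by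
        refine Finset.sum_le_sum fun x _ => ?_
        by_cases hx : ∃ w, X w = x
        · obtain ⟨w₀, rfl⟩ := hx
          have hset : (univ.filter fun w => X w = X w₀) = cls (Setoid.ker X) w₀ := by
            ext w
            simp [mem_cls, Setoid.ker_def, eq_comm]
          rw [hset]
          have : ∀ w ∈ cls (Setoid.ker X) w₀, (1 / (cls (Setoid.ker X) w).card : ℝ) =
              1 / (cls (Setoid.ker X) w₀).card := fun w hw => by rw [cls_eq (mem_cls.1 hw)]
          rw [Finset.sum_congr rfl this, Finset.sum_const, nsmul_eq_mul]
          have := card_cls_pos (Setoid.ker X) w₀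
          apply le_of_eq
          field_simp
        · push Not at hx
          rw [Finset.sum_eq_zero]
          · exact zero_le_one
          · intro w hw
            exact absurd (Finset.mem_filter.1 hw).2 (hx w)
    _ = T.card := by simp

/-- The entropy of a random variable is at most the logarithm of the number of its values. -/
lemma unifEntropy_ker_le [Nonempty M] {α : Type} (X : M → α) (T : Finset α) (hT : ∀ w, X w ∈ T) :
    unifEntropy (Setoid.ker X) ≤ Real.log T.card := by
  have hM : (0 : ℝ) < Fintype.card M := by exact_mod_cast Fintype.card_pos
  have hTpos : (0 : ℝ) < T.card := by
    exact_mod_cast Finset.card_pos.2 ⟨X (Classical.arbitrary M), hT _⟩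
  unfold unifEntropy
  rw [div_le_iff₀ hM]
  have h : ∀ w ∈ (univ : Finset M), Real.log (Fintype.card M) -
      Real.log (cls (Setoid.ker X) w).card ≤
      Real.log T.card - 1 + Fintype.card M / T.card * (1 / (cls (Setoid.ker X) w).card) := by
    intro w _
    have h1 := card_cls_pos (Setoid.ker X) w
    have := Real.log_le_sub_one_of_pos (div_pos hM (mul_pos hTpos h1))
    rw [Real.log_div hM.ne' (by positivity), Real.log_mul hTpos.ne' h1.ne'] at this
    have e : (Fintype.card M : ℝ) / (T.card * (cls (Setoid.ker X) w).card) =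
      Fintype.card M / T.card * (1 / (cls (Setoid.ker X) w).card) := by field_simp
    linarith
  refine (Finset.sum_le_sum h).trans ?_
  rw [Finset.sum_add_distrib, ← Finset.mul_sum]
  have h2 := mul_le_mul_of_nonneg_left (sum_inv_card_cls_le X T hT)
    (div_nonneg hM.le hTpos.le)
  have h3 : (Fintype.card M : ℝ) / T.card * T.card = Fintype.card M := by field_simp
  simp only [Finset.sum_const, Finset.card_univ, nsmul_eq_mul]
  linarith

open Classical in
lemma uniform_map_toReal [Nonempty M] {α : Type} (X : M → α) (x : α) :
    (((PMF.uniformOfFintype M).map X) x).toReal =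
      ((univ.filter fun w => X w = x).card : ℝ) / Fintype.card M := by
  rw [PMF.map_apply, tsum_fintype]
  simp only [PMF.uniformOfFintype_apply]
  rw [← Finset.sum_filter, Finset.sum_const, nsmul_eq_mul, ENNReal.toReal_mul, ENNReal.toReal_inv,
    ENNReal.toReal_natCast, ENNReal.toReal_natCast, div_eq_mul_inv]
  congr 3
  ext w
  simp [eq_comm]

lemma uniform_map_eq_zero [Nonempty M] {α : Type} [DecidableEq α] (X : M → α) (x : α)
    (hx : x ∉ univ.image X) : ((PMF.uniformOfFintype M).map X) x = 0 := by
  rw [PMF.apply_eq_zero_iff]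
  intro h
  rw [PMF.mem_support_map_iff] at h
  obtain ⟨w, _, rfl⟩ := h
  exact hx (Finset.mem_image_of_mem _ (mem_univ _))

lemma entropy_uniform [Nonempty M] {α : Type} (X : M → α) :
    ∑' x, Real.negMulLog (((PMF.uniformOfFintype M).map X) x).toReal =
      unifEntropy (Setoid.ker X) := by
  classical
  rw [tsum_eq_sum (s := univ.image X) fun x hx => by rw [uniform_map_eq_zero X x hx]; simp]
  unfold unifEntropy
  rw [Finset.sum_div, ← Finset.sum_fiberwise_of_maps_to (s := univ) (t := univ.image X) (g := X)
    fun w _ => Finset.mem_image_of_mem _ (mem_univ w)]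
  refine Finset.sum_congr rfl fun x hx => ?_
  obtain ⟨w₀, _, rfl⟩ := Finset.mem_image.1 hx
  rw [uniform_map_toReal]
  have hset : (univ.filter fun w => X w = X w₀) = cls (Setoid.ker X) w₀ := by
    ext w
    simp [mem_cls, Setoid.ker_def, eq_comm]
  rw [hset]
  have : ∀ w ∈ cls (Setoid.ker X) w₀,
      (Real.log (Fintype.card M) - Real.log (cls (Setoid.ker X) w).card) / Fintype.card M =
      (Real.log (Fintype.card M) - Real.log (cls (Setoid.ker X) w₀).card) / Fintype.card M :=
    fun w hw => by rw [cls_eq (mem_cls.1 hw)]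
  rw [Finset.sum_congr rfl this, Finset.sum_const, nsmul_eq_mul]
  have hp := card_cls_pos (Setoid.ker X) w₀
  have hM : (0 : ℝ) < Fintype.card M := by exact_mod_cast Fintype.card_pos
  rw [Real.negMulLog, Real.log_div hp.ne' hM.ne']
  ring

end

/-! ### Averages over the key, and conditional entropy given the queries -/

/-- The mean of `φ` under the discrete law `p`. -/
def pmfMean {F : Type} (p : PMF F) (φ : F → ℝ) : ℝ := ∑' f, (p f).toReal * φ f

section

variable {F : Type} (p : PMF F)

lemma summable_pmf : Summable fun f => (p f).toReal :=
  ENNReal.summable_toReal p.tsum_coe_ne_top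

lemma tsum_pmf_toReal : ∑' f, (p f).toReal = 1 := by
  rw [← ENNReal.tsum_toReal_eq fun f => p.apply_ne_top f, p.tsum_coe, ENNReal.toReal_one]

lemma summable_pmf_mul {φ : F → ℝ} (B : ℝ) (h0 : ∀ f, 0 ≤ φ f) (hB : ∀ f, φ f ≤ B) :
    Summable fun f => (p f).toReal * φ f :=
  Summable.of_nonneg_of_le (fun f => mul_nonneg ENNReal.toReal_nonneg (h0 f))
    (fun f => mul_le_mul_of_nonneg_left (hB f) ENNReal.toReal_nonneg)
    ((summable_pmf p).mul_right B)

lemma pmfMean_const (a : ℝ) : pmfMean p (fun _ => a) = a := by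
  rw [pmfMean, tsum_mul_right, tsum_pmf_toReal, one_mul]

lemma pmfMean_le {φ ψ : F → ℝ} (hφ : Summable fun f => (p f).toReal * φ f)
    (hψ : Summable fun f => (p f).toReal * ψ f) (h : ∀ f ∈ p.support, φ f ≤ ψ f) :
    pmfMean p φ ≤ pmfMean p ψ := by
  refine Summable.tsum_le_tsum (fun f => ?_) hφ hψ
  by_cases hf : f ∈ p.support
  · exact mul_le_mul_of_nonneg_left (h f hf) ENNReal.toReal_nonneg
  · rw [(PMF.apply_eq_zero_iff p f).2 hf]
    simp

lemma pmfMean_add {φ ψ : F → ℝ} (hφ : Summable fun f => (p f).toReal * φ f)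
    (hψ : Summable fun f => (p f).toReal * ψ f) :
    pmfMean p (fun f => φ f + ψ f) = pmfMean p φ + pmfMean p ψ := by
  simp only [pmfMean, mul_add]
  exact hφ.tsum_add hψ

/-- No summability is needed: the identity holds in `ENNReal`, where sums can be exchanged freely,
and a divergent sum gives `0` on both sides after `toReal`. -/
lemma pmfMean_map {β : Type} (g : F → β) (φ : β → ℝ) (h0 : ∀ b, 0 ≤ φ b) :
    pmfMean (p.map g) φ = pmfMean p (fun f => φ (g f)) := by
  classical
  have key : ∑' b, (p.map g) b * ENNReal.ofReal (φ b) =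
      ∑' f, p f * ENNReal.ofReal (φ (g f)) := by
    simp only [PMF.map_apply, ← ENNReal.tsum_mul_right]
    rw [ENNReal.tsum_comm]
    refine tsum_congr fun f => ?_
    rw [tsum_eq_single (g f) fun b hb => by simp [hb]]
    simp
  have conv : ∀ {A : Type} (q : PMF A) (χ : A → ℝ), (∀ a, 0 ≤ χ a) →
      pmfMean q χ = (∑' a, q a * ENNReal.ofReal (χ a)).toReal := by
    intro A q χ hχ
    rw [ENNReal.tsum_toReal_eq fun a => ENNReal.mul_ne_top (q.apply_ne_top a) ENNReal.ofReal_ne_top]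
    exact tsum_congr fun a => by rw [ENNReal.toReal_mul, ENNReal.toReal_ofReal (hχ a)]
  rw [conv _ _ h0, conv _ _ fun f => h0 (g f), key]

end

/-- The joint law of a uniform random variable on `M` and an independent one with law `p`. -/
def prodLaw (M : Type) [Fintype M] [Nonempty M] {F : Type} (p : PMF F) : PMF (M × F) :=
  (PMF.uniformOfFintype M).bind fun w => p.map fun f => (w, f)

section

variable {M : Type} [Fintype M] [Nonempty M] {F : Type} (p : PMF F)

lemma prodLaw_map_fst {α : Type} (X : M → α) :
    (prodLaw M p).map (fun ω => X ω.1) = (PMF.uniformOfFintype M).map X := by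
  rw [prodLaw, PMF.map_bind, PMF.map]
  congr 1
  funext w
  rw [PMF.map_comp]
  exact PMF.map_const p (X w)

lemma prodLaw_map_snd {β : Type} (q : F → β) :
    (prodLaw M p).map (fun ω => q ω.2) = p.map q := by
  rw [prodLaw, PMF.map_bind]
  simp only [PMF.map_comp, Function.comp_def]
  exact PMF.bind_const _ _

lemma prodLaw_map_pair {α β : Type} (q : F → β) (A : β → M → α) (x : α) (y : β) :
    ((prodLaw M p).map fun ω => (A (q ω.2) ω.1, q ω.2)) (x, y) =
      (p.map q) y * ((PMF.uniformOfFintype M).map (A y)) x := by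
  classical
  have h : ((prodLaw M p).map fun ω => (A (q ω.2) ω.1, q ω.2)) =
      (p.map q).bind fun b => ((PMF.uniformOfFintype M).map fun w => (A b w, b)) := by
    rw [prodLaw, PMF.map_bind, PMF.bind_map]
    simp only [PMF.map, PMF.bind_bind, PMF.pure_bind, Function.comp_def]
    rw [PMF.bind_comm]
  rw [h, PMF.bind_apply, tsum_eq_single y]
  · congr 1
    simp only [PMF.map_apply, Prod.mk.injEq, and_true]
  · intro b hb
    rw [PMF.map_apply]
    simp [hb.symm]

/-- Since messages and key are independent, conditioning on the queries leaves the messages uniform;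
the conditional entropy is the mean of the entropies for frozen queries. -/
lemma condEntropy_prodLaw {α β : Type} (q : F → β) (A : β → M → α) :
    condEntropy (prodLaw M p) (fun ω => A (q ω.2) ω.1) (fun ω => q ω.2) =
      pmfMean p fun f => unifEntropy (Setoid.ker (A (q f))) := by
  classical
  rw [← pmfMean_map p q (fun b => unifEntropy (Setoid.ker (A b))) fun _ => unifEntropy_nonneg _]
  unfold condEntropy
  obtain ⟨P, hP⟩ : ∃ P : β → α → ℝ,
    ∀ y x, P y x = (((PMF.uniformOfFintype M).map (A y)) x).toReal := ⟨_, fun _ _ => rfl⟩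
  have hP1 : ∀ y x, P y x ≤ 1 := fun y x => by
    rw [hP]
    exact ENNReal.toReal_le_of_le_ofReal zero_le_one
      (by rw [ENNReal.ofReal_one]; exact PMF.coe_le_one _ _)
  have hP0 : ∀ y x, 0 ≤ P y x := fun y x => by rw [hP]; exact ENNReal.toReal_nonneg
  have hterm : ∀ z : α × β,
      (((prodLaw M p).map fun ω => (A (q ω.2) ω.1, q ω.2)) z).toReal *
      Real.log ((((prodLaw M p).map fun ω => q ω.2) z.2).toReal /
        (((prodLaw M p).map fun ω => (A (q ω.2) ω.1, q ω.2)) z).toReal) =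
      ((p.map q) z.2).toReal * Real.negMulLog (P z.2 z.1) := by
    rintro ⟨x, y⟩
    rw [prodLaw_map_pair, prodLaw_map_snd, ENNReal.toReal_mul, ← hP]
    dsimp only
    rcases eq_or_ne ((p.map q) y).toReal 0 with h0 | h0
    · rw [h0]; simp
    · rw [div_mul_eq_div_div, div_self h0, one_div, Real.log_inv, Real.negMulLog]
      ring
  rw [tsum_congr hterm, ← (Equiv.prodComm β α).tsum_eq]
  simp only [Equiv.prodComm_apply, Prod.fst_swap, Prod.snd_swap]
  have hin : ∀ y, Summable fun x => Real.negMulLog (P y x) := fun y =>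
    summable_of_ne_finset_zero (s := univ.image (A y)) fun x hx => by
      rw [hP, uniform_map_eq_zero (A y) x hx]
      simp
  have hinsum : ∀ y, ∑' x, Real.negMulLog (P y x) = unifEntropy (Setoid.ker (A y)) :=
    fun y => by simp only [hP]; exact entropy_uniform (A y)
  let T : β × α → ℝ := fun z => ((p.map q) z.1).toReal * Real.negMulLog (P z.1 z.2)
  have hnn : 0 ≤ T := fun z =>
    mul_nonneg ENNReal.toReal_nonneg (Real.negMulLog_nonneg (hP0 z.1 z.2) (hP1 z.1 z.2))
  have hrow : ∀ y, Summable fun x => T (y, x) := fun y =>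
    (hin y).mul_left ((p.map q) y).toReal
  have hrowsum : ∀ y, ∑' x, T (y, x) =
      ((p.map q) y).toReal * unifEntropy (Setoid.ker (A y)) := fun y => by
    rw [← hinsum]
    exact (hin y).tsum_mul_left ((p.map q) y).toReal
  -- The alphabets may be infinite. The terms are nonnegative and each row entropy is at most `log
  -- |M|`, so the double series may be summed row by row.
  have hsum : Summable T := by
    rw [summable_prod_of_nonneg hnn]
    refine ⟨hrow, ?_⟩
    simp only [hrowsum]
    exact summable_pmf_mul (p.map q) (Real.log (Fintype.card M))
      (fun y => unifEntropy_nonneg (Setoid.ker (A y)))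
      (fun y => unifEntropy_le_log_card (Setoid.ker (A y)))
  exact (hsum.tsum_prod' hrow).trans (tsum_congr hrowsum)

end

/-! ### Entropies of a code, indexed by the levels of the servers -/

/-- The level function that is `1` on `P`, `2` on `R \ P` and `0` elsewhere. -/
def ind {N : ℕ} (P R : Finset (Fin N)) (i : Fin N) : Fin 3 :=
  if i ∈ P then 1 else if i ∈ R then 2 else 0

lemma ind_eq_one {N : ℕ} {P R : Finset (Fin N)} {i : Fin N} : ind P R i = 1 ↔ i ∈ P := by
  unfold ind
  split_ifs <;> simp_all

lemma ind_eq_two {N : ℕ} {P R : Finset (Fin N)} {i : Fin N} :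
    ind P R i = 2 ↔ i ∉ P ∧ i ∈ R := by
  unfold ind
  split_ifs <;> simp_all

namespace Code

variable {N K : ℕ} (C : Code N K)

/-- Two message tuples are equivalent if they agree on the first `t` messages, on the answers to
the queries `q` of the servers of level `1`, and on the contents of the servers of level `2`. -/
def infoAt (t : ℕ) (u : Fin N → Fin 3) (q : ∀ n, C.Q n) : Setoid C.Msg where
  r w v := (∀ n, u n = 1 → C.answer n (q n) (C.store n w) = C.answer n (q n) (C.store n v)) ∧
    (∀ n, u n = 2 → C.store n w = C.store n v) ∧ ∀ i : Fin K, (i : ℕ) < t → w i = v i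
  iseqv := by
    refine ⟨fun w => ⟨fun _ _ => rfl, fun _ _ => rfl, fun _ _ => rfl⟩, ?_, ?_⟩
    · rintro w v ⟨h1, h2, h3⟩
      exact ⟨fun n hn => (h1 n hn).symm, fun n hn => (h2 n hn).symm, fun i hi => (h3 i hi).symm⟩
    · rintro w v x ⟨h1, h2, h3⟩ ⟨g1, g2, g3⟩
      exact ⟨fun n hn => (h1 n hn).trans (g1 n hn), fun n hn => (h2 n hn).trans (g2 n hn),
        fun i hi => (h3 i hi).trans (g3 i hi)⟩

lemma infoAt_rel {t : ℕ} {u : Fin N → Fin 3} {q : ∀ n, C.Q n} {w v : C.Msg} :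
    C.infoAt t u q w v ↔
      (∀ n, u n = 1 → C.answer n (q n) (C.store n w) = C.answer n (q n) (C.store n v)) ∧
      (∀ n, u n = 2 → C.store n w = C.store n v) ∧ ∀ i : Fin K, (i : ℕ) < t → w i = v i :=
  Iff.rfl

/-- Raising a server from level `1` to level `2` only adds information, as its content determines
its answer. -/
lemma infoAt_anti (t : ℕ) {u u' : Fin N → Fin 3} (h : u ≤ u') (q : ∀ n, C.Q n) :
    C.infoAt t u' q ≤ C.infoAt t u q := by
  intro w v hwv
  rw [infoAt_rel] at hwv ⊢
  obtain ⟨h1, h2, h3⟩ := hwv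
  refine ⟨fun n hn => ?_, fun n hn => h2 n ?_, h3⟩
  · have hn' : (1 : Fin 3) ≤ u' n := hn ▸ h n
    by_cases h' : u' n = 1
    · exact h1 n h'
    · rw [h2 n (by revert hn' h'; generalize u' n = x; revert x; decide)]
  · have hn' : (2 : Fin 3) ≤ u' n := hn ▸ h n
    revert hn'
    generalize u' n = x
    revert x
    decide

/-- Levels are linearly ordered, so at each server the join is one of the two given levels and its
datum is already known. -/
lemma infoAt_inf_le (t : ℕ) (u u' : Fin N → Fin 3) (q : ∀ n, C.Q n) :
    C.infoAt t u q ⊓ C.infoAt t u' q ≤ C.infoAt t (u ⊔ u') q := by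
  rintro w v ⟨hu, hu'⟩
  have a := C.infoAt_rel.1 hu
  have b := C.infoAt_rel.1 hu'
  rw [infoAt_rel]
  refine ⟨fun n hn => ?_, fun n hn => ?_, a.2.2⟩
  · have : u n = 1 ∨ u' n = 1 := by
      rw [Pi.sup_apply] at hn
      revert hn
      generalize u n = x
      generalize u' n = y
      revert x y
      decide
    exact this.elim (a.1 n) (b.1 n)
  · have : u n = 2 ∨ u' n = 2 := by
      rw [Pi.sup_apply] at hn
      revert hn
      generalize u n = x
      generalize u' n = y
      revert x y
      decide
    exact this.elim (a.2.1 n) (b.2.1 n)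

/-- Entropy, given the key, of the first `t` messages together with the answers (for the desired
message `k`) of the servers of level `1` and the contents of the servers of level `2`. -/
def levelEntropy (k : Fin K) (t : ℕ) (u : Fin N → Fin 3) : ℝ :=
  pmfMean C.key fun f => unifEntropy (C.infoAt t u fun n => C.query k n f)

lemma summable_levelEntropy (k : Fin K) (t : ℕ) (u : Fin N → Fin 3) :
    Summable fun f => (C.key f).toReal * unifEntropy (C.infoAt t u fun n => C.query k n f) :=
  summable_pmf_mul _ (Real.log (Fintype.card C.Msg)) (fun _ => unifEntropy_nonneg _)
    fun _ => unifEntropy_le_log_card _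

lemma levelEntropy_mono (k : Fin K) (t : ℕ) : Monotone (C.levelEntropy k t) := fun u u' h =>
  pmfMean_le _ (C.summable_levelEntropy k t u) (C.summable_levelEntropy k t u')
    fun _ _ => unifEntropy_anti (C.infoAt_anti t h _)

lemma levelEntropy_submodular (k : Fin K) (t : ℕ) (u u' : Fin N → Fin 3) :
    C.levelEntropy k t (u ⊔ u') + C.levelEntropy k t (u ⊓ u') ≤
      C.levelEntropy k t u + C.levelEntropy k t u' := by
  unfold levelEntropy
  rw [← pmfMean_add _ (C.summable_levelEntropy k t _) (C.summable_levelEntropy k t _),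
    ← pmfMean_add _ (C.summable_levelEntropy k t _) (C.summable_levelEntropy k t _)]
  refine pmfMean_le _ ?_ ?_ fun f _ => ?_
  · simp only [mul_add]
    exact (C.summable_levelEntropy k t _).add (C.summable_levelEntropy k t _)
  · simp only [mul_add]
    exact (C.summable_levelEntropy k t _).add (C.summable_levelEntropy k t _)
  · have h1 := unifEntropy_submodular
      (C.infoAt_anti t (inf_le_left : u ⊓ u' ≤ u) fun n => C.query k n f)
      (C.infoAt_anti t (inf_le_right : u ⊓ u' ≤ u') fun n => C.query k n f)
    have h2 := unifEntropy_anti (C.infoAt_inf_le t u u' fun n => C.query k n f)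
    linarith

/-- If no server has level `0`, all answers are known and message `k` can be decoded. Messages are
indexed from `0`, so message `k` is the one added in passing from `k` to `k + 1` known messages. -/
lemma levelEntropy_decode (k : Fin K) {u : Fin N → Fin 3} (hu : ∀ n, u n ≠ 0) :
    C.levelEntropy k (k + 1) u ≤ C.levelEntropy k k u := by
  refine pmfMean_le _ (C.summable_levelEntropy k _ u) (C.summable_levelEntropy k _ u)
    fun f hf => unifEntropy_anti fun w v hwv => ?_
  have h := C.infoAt_rel.1 hwv
  have hk : w k = v k := by
    rw [← C.correct k f hf w, ← C.correct k f hf v]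
    congr 1
    funext n
    by_cases h1 : u n = 1
    · exact h.1 n h1
    · have h0 := hu n
      have h2 : u n = 2 := by
        revert h0 h1
        generalize u n = x
        revert x
        decide
      rw [h.2.1 n h2]
  refine C.infoAt_rel.2 ⟨h.1, h.2.1, fun i hi => ?_⟩
  rcases Nat.lt_succ_iff_lt_or_eq.1 hi with hi | hi
  · exact h.2.2 i hi
  · rw [Fin.ext hi, hk]

/-- Privacy: the entropies that involve the answer of only one server do not depend on the
desired message. -/
lemma levelEntropy_privacy (k k' : Fin K) (t : ℕ) {u : Fin N → Fin 3} (n₀ : Fin N)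
    (hu : ∀ n, n ≠ n₀ → u n ≠ 1) : C.levelEntropy k t u = C.levelEntropy k' t u := by
  obtain ⟨f₀, _⟩ := C.key.support_nonempty
  -- Only the query to `n₀` matters; the other coordinates are frozen at an arbitrary value so that
  -- the entropy becomes a function of that query alone.
  let φ : C.Q n₀ → ℝ := fun b =>
    unifEntropy (C.infoAt t u (Function.update (fun n => C.query k n f₀) n₀ b))
  have h : ∀ κ : Fin K, C.levelEntropy κ t u = pmfMean (C.key.map (C.query κ n₀)) φ := by
    intro κ
    have hφ : ∀ f, C.infoAt t u (fun n => C.query κ n f) =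
        C.infoAt t u (Function.update (fun n => C.query k n f₀) n₀ (C.query κ n₀ f)) := by
      intro f
      ext w v
      rw [infoAt_rel, infoAt_rel]
      refine and_congr_left fun _ => forall_congr' fun n => forall_congr' fun hn => ?_
      have : n = n₀ := by_contra fun hne => hu n hne hn
      subst this
      rw [Function.update_self]
    rw [pmfMean_map C.key (C.query κ n₀) φ fun _ => unifEntropy_nonneg _]
    unfold levelEntropy
    simp only [hφ, φ]
  rw [h k, h k', C.privacy n₀ k k']

/-- The entropy of one message, in nats. -/
def msgEntropy : ℝ := C.L * Real.log (Fintype.card C.X)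

lemma log_card_pos : 0 < Real.log (Fintype.card C.X) :=
  Real.log_pos (by exact_mod_cast Fintype.one_lt_card)

lemma msgEntropy_pos : 0 < C.msgEntropy :=
  mul_pos (by exact_mod_cast C.L_pos) C.log_card_pos

lemma levelEntropy_bot (k : Fin K) {t : ℕ} (ht : t ≤ K) :
    C.levelEntropy k t (ind ∅ ∅) = t * C.msgEntropy := by
  classical
  have hX : (Fintype.card C.X : ℝ) ≠ 0 := by exact_mod_cast Fintype.card_ne_zero
  have hc : ∀ q : ∀ n, C.Q n, unifEntropy (C.infoAt t (ind ∅ ∅) q) = t * C.msgEntropy := by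
    intro q
    have hcls : ∀ w : C.Msg, Real.log (Fintype.card C.Msg) -
        Real.log (cls (C.infoAt t (ind ∅ ∅) q) w).card = t * C.msgEntropy := by
      intro w
      have hset : cls (C.infoAt t (ind ∅ ∅) q) w =
          Fintype.piFinset fun i : Fin K => if (i : ℕ) < t then {w i} else univ := by
        ext v
        rw [mem_cls, infoAt_rel, Fintype.mem_piFinset]
        simp only [ind, notMem_empty, if_false]
        constructor
        · rintro ⟨_, _, h⟩ i
          split_ifs with hi
          · simp [h i hi]
          · simp
        · intro h
          refine ⟨fun n hn => absurd hn (by decide), fun n hn => absurd hn (by decide),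
            fun i hi => ?_⟩
          have := h i
          rw [if_pos hi, mem_singleton] at this
          exact this.symm
      have hfun : (Fintype.card (Fin C.L → C.X) : ℝ) ≠ 0 := by
        exact_mod_cast Fintype.card_ne_zero
      have hlog : Real.log (Fintype.card (Fin C.L → C.X)) = C.msgEntropy := by
        rw [Fintype.card_fun, Fintype.card_fin, Nat.cast_pow, Real.log_pow, msgEntropy]
      rw [hset, Fintype.card_piFinset, Fintype.card_fun, Fintype.card_fin, Nat.cast_pow,
        Real.log_pow, hlog, Nat.cast_prod, Real.log_prod]
      · have hterm : ∀ i : Fin K, Real.log (((if (i : ℕ) < t then ({w i} : Finset _) else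
            univ).card : ℕ) : ℝ) = C.msgEntropy - if (i : ℕ) < t then C.msgEntropy else 0 := by
          intro i
          split_ifs
          · simp
          · rw [Finset.card_univ, hlog, sub_zero]
        simp only [hterm, Finset.sum_sub_distrib]
        rw [← Finset.sum_filter, Finset.sum_const, Finset.sum_const, Fin.card_filter_val_lt,
          min_eq_right ht, Finset.card_univ, Fintype.card_fin]
        simp only [nsmul_eq_mul]
        ring
      · intro i _
        split_ifs
        · simp
        · rw [Finset.card_univ]
          exact hfun
    unfold unifEntropy
    simp only [hcls]
    rw [Finset.sum_const, Finset.card_univ, nsmul_eq_mul]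
    have : (Fintype.card C.Msg : ℝ) ≠ 0 := by exact_mod_cast Fintype.card_ne_zero
    field_simp
  unfold levelEntropy
  simp only [hc]
  exact pmfMean_const _ _

lemma infoAt_answer (n : Fin N) (q : ∀ n, C.Q n) :
    C.infoAt 0 (ind {n} ∅) q = Setoid.ker fun w => C.answer n (q n) (C.store n w) := by
  ext w v
  rw [infoAt_rel, Setoid.ker_def]
  simp [ind_eq_one, ind_eq_two]

lemma infoAt_stored (n : Fin N) (q : ∀ n, C.Q n) :
    C.infoAt 0 (ind ∅ {n}) q = Setoid.ker (C.store n) := by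
  ext w v
  rw [infoAt_rel, Setoid.ker_def]
  simp [ind_eq_one, ind_eq_two]

lemma levelEntropy_stored_eq (k : Fin K) (n : Fin N) :
    C.levelEntropy k 0 (ind ∅ {n}) = unifEntropy (Setoid.ker (C.store n)) := by
  unfold levelEntropy
  simp only [infoAt_stored]
  exact pmfMean_const _ _

lemma entropy_stored (k : Fin K) (n : Fin N) :
    entropy C.law (C.stored n) = C.levelEntropy k 0 (ind ∅ {n}) := by
  have h : C.law.map (C.stored n) = (PMF.uniformOfFintype C.Msg).map (C.store n) :=
    prodLaw_map_fst C.key (C.store n)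
  rw [entropy, h, levelEntropy_stored_eq]
  exact entropy_uniform (C.store n)

lemma condEntropy_ans (k : Fin K) (n : Fin N) :
    condEntropy C.law (C.ans k n) (C.queries k) = C.levelEntropy k 0 (ind {n} ∅) := by
  unfold levelEntropy
  simp only [infoAt_answer]
  exact condEntropy_prodLaw C.key (fun f n => C.query k n f)
    fun q w => C.answer n (q n) (C.store n w)

lemma levelEntropy_stored_le (k : Fin K) (n : Fin N) :
    C.levelEntropy k 0 (ind ∅ {n}) ≤ Real.log (Fintype.card (C.S n)) := by
  rw [levelEntropy_stored_eq]
  exact unifEntropy_ker_le (C.store n) univ fun w => mem_univ _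

lemma levelEntropy_answer_le (hC : C.FiniteLength) (k : Fin K) (n : Fin N) :
    C.levelEntropy k 0 (ind {n} ∅) ≤ C.expLength k n * Real.log (Fintype.card C.Y) := by
  classical
  have h : ∀ f, unifEntropy (C.infoAt 0 (ind {n} ∅) fun n => C.query k n f) ≤
      C.len n (C.query k n f) * Real.log (Fintype.card C.Y) := by
    intro f
    rw [infoAt_answer]
    let T : Finset (List C.Y) :=
      (univ : Finset (List.Vector C.Y (C.len n (C.query k n f)))).map 
        ⟨List.Vector.toList, List.Vector.toList_injective⟩
    have hT : T.card = Fintype.card C.Y ^ C.len n (C.query k n f) := by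
      rw [Finset.card_map, Finset.card_univ, card_vector]
    have := unifEntropy_ker_le (fun w => C.answer n (C.query k n f) (C.store n w)) T fun w =>
      Finset.mem_map.2 ⟨⟨_, C.length_answer n _ _⟩, mem_univ _, rfl⟩
    rwa [hT, Nat.cast_pow, Real.log_pow] at this
  unfold expLength
  -- Finite expected length is essential here: for a divergent series the `tsum` in `expLength`
  -- would be `0`.
  rw [← (hC k n).tsum_mul_right]
  refine Summable.tsum_le_tsum (fun f => ?_) (C.summable_levelEntropy k 0 _)
    ((hC k n).mul_right _)
  rw [mul_assoc]
  exact mul_le_mul_of_nonneg_left (h f) ENNReal.toReal_nonneg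

lemma infoStorage_eq (k : Fin K) :
    C.infoStorage = (∑ n, C.levelEntropy k 0 (ind ∅ {n})) / (N * C.msgEntropy) := by
  unfold infoStorage msgEntropy
  simp only [C.entropy_stored k]
  rw [← Finset.sum_div, one_div_mul_eq_div, div_div]
  congr 1
  ring

lemma infoDownload_eq (k : Fin K) :
    C.infoDownload k = (∑ n, C.levelEntropy k 0 (ind {n} ∅)) / (N * C.msgEntropy) := by
  unfold infoDownload msgEntropy
  simp only [C.condEntropy_ans k]
  rw [← Finset.sum_div, one_div_mul_eq_div, div_div]
  congr 1
  ring

lemma infoStorage_le_opStorage (k : Fin K) : C.infoStorage ≤ C.opStorage := by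
  unfold infoStorage opStorage
  refine mul_le_mul_of_nonneg_left (Finset.sum_le_sum fun n _ => ?_) (by positivity)
  rw [C.entropy_stored k, Real.logb]
  exact div_le_div_of_nonneg_right (C.levelEntropy_stored_le k n) C.log_card_pos.le

lemma infoDownload_le_opDownload (hC : C.FiniteLength) (k : Fin K) :
    C.infoDownload k ≤ C.opDownload k := by
  unfold infoDownload opDownload
  calc _ ≤ 1 / ((N : ℝ) * C.L) *
        ∑ n, C.expLength k n * Real.logb (Fintype.card C.X) (Fintype.card C.Y) := by
        refine mul_le_mul_of_nonneg_left (Finset.sum_le_sum fun n _ => ?_) (by positivity)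
        rw [C.condEntropy_ans k, Real.logb, mul_div_assoc']
        exact div_le_div_of_nonneg_right (C.levelEntropy_answer_le hC k n) C.log_card_pos.le
    _ = _ := by
        rw [← Finset.sum_mul]
        ring

end Code

/-! ### Symmetrization over the servers -/

lemma exists_perm_comp_eq {ι α : Type} [Fintype ι] [DecidableEq α] {u v : ι → α}
    (h : ∀ x, (univ.filter fun i => u i = x).card = (univ.filter fun i => v i = x).card) :
    ∃ τ : Equiv.Perm ι, v ∘ τ = u := by
  have e : ∀ x, Nonempty ({i // u i = x} ≃ {i // v i = x}) := fun x => by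
    refine ⟨Fintype.equivOfCardEq ?_⟩
    rw [Fintype.card_subtype, Fintype.card_subtype, h]
  let τ : ι ≃ ι := (Equiv.sigmaFiberEquiv u).symm.trans
    ((Equiv.sigmaCongrRight fun x => (e x).some).trans (Equiv.sigmaFiberEquiv v))
  refine ⟨τ, funext fun i => ?_⟩
  exact ((e (u i)).some ⟨i, rfl⟩).2

/-- Monotone, submodular functions on levels that are invariant under permuting the servers. -/
structure IsSymSubmodular {N : ℕ} (F : (Fin N → Fin 3) → ℝ) : Prop where
  mono : Monotone F
  submodular : ∀ u v, F (u ⊔ v) + F (u ⊓ v) ≤ F u + F v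
  symm : ∀ (τ : Equiv.Perm (Fin N)) u, F (u ∘ τ) = F u

/-- The average of a function over all the permutations of the servers. -/
def symmetrize {N : ℕ} (f : (Fin N → Fin 3) → ℝ) (u : Fin N → Fin 3) : ℝ :=
  (∑ σ : Equiv.Perm (Fin N), f (u ∘ σ)) / (Fintype.card (Equiv.Perm (Fin N)) : ℝ)

section

variable {N : ℕ} {f g : (Fin N → Fin 3) → ℝ}

lemma isSymSubmodular_symmetrize (hmono : Monotone f)
    (hsub : ∀ u v, f (u ⊔ v) + f (u ⊓ v) ≤ f u + f v) : IsSymSubmodular (symmetrize f) where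
  mono u v h := div_le_div_of_nonneg_right
    (Finset.sum_le_sum fun σ _ => hmono fun i => h (σ i)) (Nat.cast_nonneg _)
  submodular u v := by
    unfold symmetrize
    rw [← add_div, ← add_div, ← Finset.sum_add_distrib, ← Finset.sum_add_distrib]
    exact div_le_div_of_nonneg_right
      (Finset.sum_le_sum fun σ _ => hsub (u ∘ σ) (v ∘ σ)) (Nat.cast_nonneg _)
  symm τ u := by
    unfold symmetrize
    congr 1
    exact Fintype.sum_equiv (Equiv.mulLeft τ) _ _ fun σ => rfl

lemma symmetrize_le {u v : Fin N → Fin 3}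
    (h : ∀ σ : Equiv.Perm (Fin N), f (u ∘ σ) ≤ g (v ∘ σ)) : symmetrize f u ≤ symmetrize g v :=
  div_le_div_of_nonneg_right (Finset.sum_le_sum fun σ _ => h σ) (Nat.cast_nonneg _)

lemma symmetrize_eq_of_forall {u : Fin N → Fin 3} {a : ℝ}
    (h : ∀ σ : Equiv.Perm (Fin N), f (u ∘ σ) = a) : symmetrize f u = a := by
  unfold symmetrize
  rw [Finset.sum_congr rfl fun σ _ => h σ, Finset.sum_const, Finset.card_univ, nsmul_eq_mul]
  have : (Fintype.card (Equiv.Perm (Fin N)) : ℝ) ≠ 0 := by exact_mod_cast Fintype.card_ne_zero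
  field_simp

lemma ind_comp_perm (P R : Finset (Fin N)) (σ : Equiv.Perm (Fin N)) :
    ind P R ∘ σ = ind (P.map σ.symm.toEmbedding) (R.map σ.symm.toEmbedding) := by
  funext i
  simp [ind, Finset.mem_map_equiv]

/-- The value of a symmetric function at `a` answers and `b` stored contents. -/
def profile (F : (Fin N → Fin 3) → ℝ) (a b : ℕ) : ℝ :=
  F (ind (univ.filter fun i : Fin N => (i : ℕ) < a)
    (univ.filter fun i : Fin N => a ≤ (i : ℕ) ∧ (i : ℕ) < a + b))

lemma exists_disjoint_card {a b : ℕ} (h : a + b ≤ N) :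
    ∃ P R : Finset (Fin N), Disjoint P R ∧ P.card = a ∧ R.card = b ∧
      P = (univ.filter fun i : Fin N => (i : ℕ) < a) ∧
      R = (univ.filter fun i : Fin N => a ≤ (i : ℕ) ∧ (i : ℕ) < a + b) := by
  have hd : Disjoint (univ.filter fun i : Fin N => (i : ℕ) < a)
      (univ.filter fun i : Fin N => a ≤ (i : ℕ) ∧ (i : ℕ) < a + b) := by
    rw [Finset.disjoint_filter]
    intro i _ h1 h2
    omega
  have h1 : (univ.filter fun i : Fin N => (i : ℕ) < a).card = a := by
    rw [Fin.card_filter_val_lt]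
    omega
  refine ⟨_, _, hd, h1, ?_, rfl, rfl⟩
  have h2 := Finset.card_union_of_disjoint hd
  have h3 : (univ.filter fun i : Fin N => (i : ℕ) < a) ∪
      (univ.filter fun i : Fin N => a ≤ (i : ℕ) ∧ (i : ℕ) < a + b) =
      univ.filter fun i : Fin N => (i : ℕ) < a + b := by
    ext i
    simp only [mem_union, mem_filter, mem_univ, true_and]
    omega
  rw [h3, h1, Fin.card_filter_val_lt] at h2
  omega

lemma card_ind_eq {P R : Finset (Fin N)} (hd : Disjoint P R) (x : Fin 3) :
    (univ.filter fun i => ind P R i = x).card =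
      if x = 1 then P.card else if x = 2 then R.card else N - (P.card + R.card) := by
  have h1 : (univ.filter fun i => ind P R i = 1) = P := by ext i; simp [ind_eq_one]
  have h2 : (univ.filter fun i => ind P R i = 2) = R := by
    ext i
    simp only [mem_filter, mem_univ, true_and, ind_eq_two]
    exact ⟨fun h => h.2, fun h => ⟨Finset.disjoint_right.1 hd h, h⟩⟩
  have h0 : (univ.filter fun i => ind P R i = 0) = (P ∪ R)ᶜ := by
    ext i
    rw [mem_filter, mem_compl, mem_union, ind]
    by_cases hP : i ∈ P <;> by_cases hR : i ∈ R <;> simp [hP, hR]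
  fin_cases x
  · simp [-Finset.compl_union, h0, Finset.card_compl, Finset.card_union_of_disjoint hd]
  · simp [h1]
  · simp [h2]

/-- Level functions with equal fibre sizes differ by a permutation of the servers. This allows each
inequality below to be checked on conveniently chosen sets. -/
lemma IsSymSubmodular.eq_profile {F : (Fin N → Fin 3) → ℝ} (hF : IsSymSubmodular F)
    {P R : Finset (Fin N)} (hd : Disjoint P R) {a b : ℕ} (ha : P.card = a) (hb : R.card = b) :
    F (ind P R) = profile F a b := by
  have hcard : a + b ≤ N := by
    have := Finset.card_le_univ (P ∪ R)
    rw [Finset.card_union_of_disjoint hd, Fintype.card_fin] at this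
    omega
  obtain ⟨P', R', hd', hP', hR', hP'', hR''⟩ := exists_disjoint_card hcard
  obtain ⟨τ, hτ⟩ := exists_perm_comp_eq (u := ind P R) (v := ind P' R') fun x => by
    rw [card_ind_eq hd, card_ind_eq hd', hP', hR', ha, hb]
  rw [← hτ, hF.symm, profile, ← hP'', ← hR'']

lemma exists_notMem {P : Finset (Fin N)} (h : P.card < N) : ∃ x, x ∉ P := by
  by_contra hc
  push Not at hc
  rw [Finset.eq_univ_iff_forall.2 hc, Finset.card_univ, Fintype.card_fin] at h
  exact lt_irrefl _ h

lemma exists_disjoint_card_notMem {a b : ℕ} (h : a + b + 1 ≤ N) :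
    ∃ (P R : Finset (Fin N)) (x : Fin N), Disjoint P R ∧ P.card = a ∧ R.card = b ∧
      x ∉ P ∧ x ∉ R := by
  obtain ⟨P, R, hd, hP, hR, _⟩ := exists_disjoint_card (N := N) (a := a) (b := b) (by omega)
  obtain ⟨x, hx⟩ := exists_notMem (P := P ∪ R)
    (by rw [Finset.card_union_of_disjoint hd]; omega)
  rw [mem_union, not_or] at hx
  exact ⟨P, R, x, hd, hP, hR, hx.1, hx.2⟩

variable {F : (Fin N → Fin 3) → ℝ}

lemma IsSymSubmodular.submodular_of_eq (hF : IsSymSubmodular F) {u v s t : Fin N → Fin 3}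
    (hs : ∀ i, u i ⊔ v i = s i) (ht : ∀ i, u i ⊓ v i = t i) : F s + F t ≤ F u + F v := by
  have h := hF.submodular u v
  rwa [show u ⊔ v = s from funext hs, show u ⊓ v = t from funext ht] at h

/-- The answer of a new server adds less when `a` known answers are upgraded to contents. The two
level functions are `P ∪ {x}` answered with `R` stored, and `P ∪ R` stored. -/
lemma IsSymSubmodular.answer_after_answers (hF : IsSymSubmodular F) {a b : ℕ}
    (h : a + b + 1 ≤ N) : profile F a b + profile F 1 (a + b) ≤
      profile F (a + 1) b + profile F 0 (a + b) := by
  obtain ⟨P, R, x, hd, hP, hR, hxP, hxR⟩ := exists_disjoint_card_notMem h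
  have hPR : (P ∪ R).card = a + b := by rw [Finset.card_union_of_disjoint hd, hP, hR]
  rw [← hF.eq_profile hd hP hR, ← hF.eq_profile (P := {x}) (R := P ∪ R) (by simp [hxP, hxR])
    (Finset.card_singleton x) hPR, ← hF.eq_profile (P := insert x P) (R := R) (by simp [hd, hxR])
    (by rw [Finset.card_insert_of_notMem hxP, hP]) hR,
    ← hF.eq_profile (P := ∅) (R := P ∪ R) (by simp) Finset.card_empty hPR, add_comm]
  apply hF.submodular_of_eq <;> intro i <;>
  have hdi : i ∈ P → i ∉ R := (Finset.disjoint_left.1 hd ·) <;>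
  by_cases hiP : i ∈ P <;> by_cases hiR : i ∈ R <;> by_cases hix : i = x <;>
  simp_all [ind]

/-- Take `P` answered with `R ∪ {x}` stored, and `x` answered with `R ∪ P` stored. Their join stores
everything; their meet has `P ∪ {x}` answered and `R` stored. -/
lemma IsSymSubmodular.answer_exchange (hF : IsSymSubmodular F) {n b : ℕ}
    (h : n + b + 1 ≤ N) : profile F 0 (b + n + 1) + profile F (n + 1) b ≤
      profile F n (b + 1) + profile F 1 (b + n) := by
  obtain ⟨P, R, x, hd, hP, hR, hxP, hxR⟩ := exists_disjoint_card_notMem h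
  have hRP : (R ∪ P).card = b + n := by rw [Finset.card_union_of_disjoint hd.symm, hP, hR]
  have hx : x ∉ R ∪ P := by simp [hxP, hxR]
  rw [← hF.eq_profile (P := ∅) (R := insert x (R ∪ P)) (by simp) Finset.card_empty
      (by rw [Finset.card_insert_of_notMem hx, hRP]),
    ← hF.eq_profile (P := insert x P) (R := R) (by simp [hd, hxR])
      (by rw [Finset.card_insert_of_notMem hxP, hP]) hR,
    ← hF.eq_profile (P := P) (R := insert x R) (by simp [hd, hxP]) hP
      (by rw [Finset.card_insert_of_notMem hxR, hR]),
    ← hF.eq_profile (P := {x}) (R := R ∪ P) (by simpa using hx) (Finset.card_singleton x) hRP]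
  apply hF.submodular_of_eq <;> intro i <;>
  have hdi : i ∈ P → i ∉ R := (Finset.disjoint_left.1 hd ·) <;>
  by_cases hiP : i ∈ P <;> by_cases hiR : i ∈ R <;> by_cases hix : i = x <;>
  simp_all [ind]

lemma exists_disjoint_card_notMem_two {a b : ℕ} (h : a + b + 2 ≤ N) :
    ∃ (P R : Finset (Fin N)) (x y : Fin N), Disjoint P R ∧ P.card = a ∧ R.card = b ∧
      x ∉ P ∧ x ∉ R ∧ y ∉ P ∧ y ∉ R ∧ x ≠ y := by
  obtain ⟨P, R, x, hd, hP, hR, hxP, hxR⟩ :=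
    exists_disjoint_card_notMem (N := N) (a := a + 1) (b := b) (by omega)
  obtain ⟨y, hy⟩ : P.Nonempty := Finset.card_pos.1 (by omega)
  refine ⟨P.erase y, R, x, y, Finset.disjoint_of_subset_left (Finset.erase_subset _ _) hd,
    by rw [Finset.card_erase_of_mem hy]; omega, hR, fun h => hxP (Finset.mem_of_mem_erase h), hxR,
    Finset.notMem_erase _ _, Finset.disjoint_left.1 hd hy, fun h => hxP (h ▸ hy)⟩

lemma IsSymSubmodular.concave_answer (hF : IsSymSubmodular F) {a b : ℕ}
    (h : a + b + 2 ≤ N) : profile F a b + profile F (a + 2) b ≤ 2 * profile F (a + 1) b := by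
  obtain ⟨P, R, x, y, hd, hP, hR, hxP, hxR, hyP, hyR, hxy⟩ := exists_disjoint_card_notMem_two h
  have hx : x ∉ insert y P := by simp [hxy, hxP]
  have h1 := hF.eq_profile (P := insert x P) (R := R) (by simp [hd, hxR])
      (Finset.card_insert_of_notMem hxP) hR
  have h2 := hF.eq_profile (P := insert y P) (R := R) (by simp [hd, hyR])
      (Finset.card_insert_of_notMem hyP) hR
  have h3 := hF.eq_profile (P := insert x (insert y P)) (R := R) (by simp [hd, hyR, hxR])
      (by rw [Finset.card_insert_of_notMem hx, Finset.card_insert_of_notMem hyP]) hR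
  rw [hP] at h1 h2 h3
  rw [two_mul, add_comm, ← hF.eq_profile hd hP hR, ← h3]
  -- The two equal terms are realized on different sets, one with `x` and one with `y`, whose join
  -- and meet are the other two terms.
  nth_rewrite 1 [← h1]
  rw [← h2]
  apply hF.submodular_of_eq <;> intro i <;>
  have hdi : i ∈ P → i ∉ R := (Finset.disjoint_left.1 hd ·) <;>
  by_cases hiP : i ∈ P <;> by_cases hiR : i ∈ R <;> by_cases hix : i = x <;>
  by_cases hiy : i = y <;> simp_all [ind]

lemma IsSymSubmodular.concave_stored (hF : IsSymSubmodular F) {b : ℕ}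
    (h : b + 2 ≤ N) : profile F 0 b + profile F 0 (b + 2) ≤ 2 * profile F 0 (b + 1) := by
  obtain ⟨P, R, x, y, hd, hP, hR, -, hxR, -, hyR, hxy⟩ :=
    exists_disjoint_card_notMem_two (N := N) (a := 0) (b := b) (by omega)
  have hx : x ∉ insert y R := by simp [hxy, hxR]
  have h0 := hF.eq_profile (P := ∅) (R := R) (by simp) Finset.card_empty hR
  have h1 := hF.eq_profile (P := ∅) (R := insert x R) (by simp) Finset.card_empty
    (Finset.card_insert_of_notMem hxR)
  have h2 := hF.eq_profile (P := ∅) (R := insert y R) (by simp) Finset.card_empty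
    (Finset.card_insert_of_notMem hyR)
  have h3 := hF.eq_profile (P := ∅) (R := insert x (insert y R)) (by simp) Finset.card_empty
    (by rw [Finset.card_insert_of_notMem hx, Finset.card_insert_of_notMem hyR])
  rw [hR] at h1 h2 h3
  rw [two_mul, add_comm, ← h0, ← h3]
  nth_rewrite 1 [← h1]
  rw [← h2]
  apply hF.submodular_of_eq <;> intro i <;>
  by_cases hiR : i ∈ R <;> by_cases hix : i = x <;>
  by_cases hiy : i = y <;> simp_all [ind]

lemma IsSymSubmodular.profile_mono_answer (hF : IsSymSubmodular F) {b : ℕ} (h : b + 1 ≤ N) :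
    profile F 0 b ≤ profile F 1 b := by
  obtain ⟨P, R, x, hd, hP, hR, hxP, hxR⟩ :=
    exists_disjoint_card_notMem (N := N) (a := 0) (b := b) (by omega)
  rw [← hF.eq_profile (P := ∅) (R := R) (by simp) Finset.card_empty hR,
    ← hF.eq_profile (P := {x}) (R := R) (by simp [hxR]) (Finset.card_singleton x) hR]
  refine hF.mono fun i => ?_
  by_cases hiR : i ∈ R <;> by_cases hix : i = x <;> simp_all [ind]

lemma IsSymSubmodular.profile_bot_le (hF : IsSymSubmodular F) (a b : ℕ) :
    profile F 0 0 ≤ profile F a b := by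
  refine hF.mono fun i => ?_
  simp [ind]

lemma IsSymSubmodular.add_answer_le (hF : IsSymSubmodular F) {a b : ℕ} (h : a + b + 1 ≤ N) :
    profile F (a + 1) b + profile F 0 0 ≤ profile F a b + profile F 1 0 := by
  obtain ⟨P, R, x, hd, hP, hR, hxP, hxR⟩ := exists_disjoint_card_notMem h
  rw [← hF.eq_profile hd hP hR, ← hF.eq_profile (P := ∅) (R := ∅) (by simp) Finset.card_empty
      Finset.card_empty, ← hF.eq_profile (P := insert x P) (R := R) (by simp [hd, hxR])
    (by rw [Finset.card_insert_of_notMem hxP, hP]) hR,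
    ← hF.eq_profile (P := {x}) (R := ∅) (by simp) (Finset.card_singleton x) Finset.card_empty]
  apply hF.submodular_of_eq <;> intro i <;>
  have hdi : i ∈ P → i ∉ R := (Finset.disjoint_left.1 hd ·) <;>
  by_cases hiP : i ∈ P <;> by_cases hiR : i ∈ R <;> by_cases hix : i = x <;>
  simp_all [ind]

lemma IsSymSubmodular.add_stored_le (hF : IsSymSubmodular F) {a b : ℕ} (h : a + b + 1 ≤ N) :
    profile F a (b + 1) + profile F 0 0 ≤ profile F a b + profile F 0 1 := by
  obtain ⟨P, R, x, hd, hP, hR, hxP, hxR⟩ := exists_disjoint_card_notMem h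
  rw [← hF.eq_profile hd hP hR, ← hF.eq_profile (P := ∅) (R := ∅) (by simp) Finset.card_empty
      Finset.card_empty, ← hF.eq_profile (P := P) (R := insert x R) (by simp [hd, hxP]) hP
    (by rw [Finset.card_insert_of_notMem hxR, hR]),
    ← hF.eq_profile (P := ∅) (R := {x}) (by simp) Finset.card_empty (Finset.card_singleton x)]
  apply hF.submodular_of_eq <;> intro i <;>
  have hdi : i ∈ P → i ∉ R := (Finset.disjoint_left.1 hd ·) <;>
  by_cases hiP : i ∈ P <;> by_cases hiR : i ∈ R <;> by_cases hix : i = x <;>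
  simp_all [ind]

lemma IsSymSubmodular.profile_subadditive (hF : IsSymSubmodular F) (h0 : profile F 0 0 = 0)
    {a b : ℕ} (h : a + b ≤ N) : profile F a b ≤ a * profile F 1 0 + b * profile F 0 1 := by
  induction a with
  | zero =>
    induction b with
    | zero => simp [h0]
    | succ b ih =>
      have h1 := ih (by omega)
      have h2 := hF.add_stored_le (a := 0) (b := b) (by omega)
      push_cast at h1 ⊢
      linarith
  | succ a ih =>
    have h1 := ih (by omega)
    have h2 := hF.add_answer_le (a := a) (b := b) (by omega)
    push_cast at h1 ⊢
    linarith

/-- Averages of the value at a single server do not depend on the server. -/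
lemma card_mul_symmetrize_eq (u : Fin N → Fin N → Fin 3)
    (hu : ∀ x (σ : Equiv.Perm (Fin N)), u x ∘ σ = u (σ.symm x)) (G : ℝ)
    (hG : ∀ x, symmetrize f (u x) = G) : N * G = ∑ x, f (u x) := by
  have h1 : ∑ x, symmetrize f (u x) = N * G := by
    simp [hG]
  rw [← h1]
  unfold symmetrize
  rw [← Finset.sum_div, Finset.sum_comm]
  have h2 : ∀ σ : Equiv.Perm (Fin N), ∑ x, f (u x ∘ σ) = ∑ x, f (u x) := fun σ => by
    simp only [hu]
    exact Equiv.sum_comp σ.symm fun x => f (u x)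
  rw [Finset.sum_congr rfl fun σ _ => h2 σ, Finset.sum_const, Finset.card_univ, nsmul_eq_mul]
  have : (Fintype.card (Equiv.Perm (Fin N)) : ℝ) ≠ 0 := by exact_mod_cast Fintype.card_ne_zero
  field_simp

lemma card_mul_profile_answer (hF : IsSymSubmodular (symmetrize f)) :
    N * profile (symmetrize f) 1 0 = ∑ x, f (ind {x} ∅) :=
  card_mul_symmetrize_eq (fun x => ind {x} ∅) (fun x σ => by rw [ind_comp_perm]; simp) _
    fun x => hF.eq_profile (by simp) (Finset.card_singleton x) Finset.card_empty

lemma card_mul_profile_stored (hF : IsSymSubmodular (symmetrize f)) :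
    N * profile (symmetrize f) 0 1 = ∑ x, f (ind ∅ {x}) :=
  card_mul_symmetrize_eq (fun x => ind ∅ {x}) (fun x σ => by rw [ind_comp_perm]; simp) _
    fun x => hF.eq_profile (by simp) Finset.card_empty (Finset.card_singleton x)

end

/-! ### Consequences of submodularity for profiles -/

/-- The inequalities satisfied by the averaged entropies `g a b` of `a` answers and `b` stored
contents of `a + b` distinct servers out of `N`. -/
structure IsProfile (N : ℕ) (g : ℕ → ℕ → ℝ) : Prop where
  zero : g 0 0 = 0
  nonneg : ∀ a b, 0 ≤ g a b
  le_answer : ∀ b, b + 1 ≤ N → g 0 b ≤ g 1 b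
  answer_after_answers : ∀ a b, a + b + 1 ≤ N → g a b + g 1 (a + b) ≤ g (a + 1) b + g 0 (a + b)
  answer_exchange : ∀ n b, n + b + 1 ≤ N →
    g 0 (b + n + 1) + g (n + 1) b ≤ g n (b + 1) + g 1 (b + n)
  concave_answer : ∀ a b, a + b + 2 ≤ N → g a b + g (a + 2) b ≤ 2 * g (a + 1) b
  concave_stored : ∀ b, b + 2 ≤ N → g 0 b + g 0 (b + 2) ≤ 2 * g 0 (b + 1)

/-- A concave sequence starting at `0` has nonincreasing `φ n / n`; applied to profiles, this is
Han's inequality. -/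
lemma mul_le_mul_of_concave {φ : ℕ → ℝ} {T : ℕ} (h0 : φ 0 = 0)
    (hc : ∀ a, a + 2 ≤ T → φ a + φ (a + 2) ≤ 2 * φ (a + 1)) {n p : ℕ} (hnp : n ≤ p)
    (hp : p ≤ T) : n * φ p ≤ p * φ n := by
  have step : ∀ a : ℕ, a + 1 ≤ T → a * φ (a + 1) ≤ (a + 1) * φ a := by
    intro a
    induction a with
    | zero => simp [h0]
    | succ a ih =>
      intro ha
      have h1 := ih (by omega)
      have h2 := hc a (by omega)
      have h3 := mul_le_mul_of_nonneg_left h2 (by positivity : (0 : ℝ) ≤ (a : ℝ) + 1)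
      push_cast
      have e : a + 1 + 1 = a + 2 := rfl
      rw [e]
      nlinarith
  induction p, hnp using Nat.le_induction with
  | base => exact le_rfl
  | succ p hnp ih =>
    rcases Nat.eq_zero_or_pos n with rfl | hn
    · simp [h0]
    · have hpp : (0 : ℝ) < p := by exact_mod_cast hn.trans_le hnp
      have h1 := mul_le_mul_of_nonneg_left (step p hp) (Nat.cast_nonneg n : (0 : ℝ) ≤ n)
      have h2 := mul_le_mul_of_nonneg_left (ih (by omega)) (by positivity : (0 : ℝ) ≤ (p : ℝ) + 1)
      refine le_of_mul_le_mul_left ?_ hpp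
      push_cast
      nlinarith

namespace IsProfile

variable {N : ℕ} {g : ℕ → ℕ → ℝ}

/-- Chain rule: the increment due to each further answer is bounded below by its increment given
contents in place of the earlier answers. -/
lemma chain (hg : IsProfile N g) {m b : ℕ} (h : m + b ≤ N) :
    g 0 b + ∑ a ∈ range m, (g 1 (a + b) - g 0 (a + b)) ≤ g m b := by
  induction m with
  | zero => simp
  | succ m ih =>
    rw [sum_range_succ]
    have h1 := ih (by omega)
    have h2 := hg.answer_after_answers m b (by omega)
    linarith

/-- `answer_exchange` telescoped: each step trades one content for an answer and uses one more copy
of `g 1 (b + n)`. -/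
lemma exchange (hg : IsProfile N g) {n b : ℕ} (h : n + 1 + b ≤ N) :
    n * g 0 (b + n + 1) + g (n + 1) b ≤ (n + 1) * g 1 (b + n) := by
  induction n generalizing b with
  | zero => simp
  | succ n ih =>
    have h1 := ih (b := b + 1) (by omega)
    have h2 := hg.answer_exchange (n + 1) b (by omega)
    have e1 : b + 1 + n + 1 = b + (n + 1) + 1 := by ring
    have e2 : b + 1 + n = b + (n + 1) := by ring
    rw [e1, e2] at h1
    push_cast
    linarith

/-- A single answer together with `N - j` contents, compared with `j + n - 1` answers. -/
lemma window (hg : IsProfile N g) {j n : ℕ} (hj : 1 ≤ j) (hn : 1 ≤ n) (h : j + n ≤ N + 1) :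
    ((n : ℝ) - 1) / n * g 0 (N + 1 - j) +
      (1 / (n : ℝ) - 1 / ((j : ℝ) + n - 1)) * g 0 (N + 1 - (j + n)) +
      1 / ((j : ℝ) + n - 1) * g (j + n - 1) (N - (j + n - 1)) ≤ g 1 (N - j) := by
  obtain ⟨n, rfl⟩ := Nat.exists_eq_add_of_le' hn
  obtain ⟨j, rfl⟩ := Nat.exists_eq_add_of_le' hj
  obtain ⟨b, rfl⟩ : ∃ b, N = b + (j + n + 1) := ⟨N - (j + n + 1), by omega⟩
  have h1 := hg.exchange (n := n) (b := b) (by omega)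
  -- After `j` and `n` are shifted by one and `N = b + (j + n + 1)`, this is Han's inequality for
  -- answers given `b` contents, comparing `n + 1` of them with all `j + n + 1`.
  have h2 := mul_le_mul_of_concave (φ := fun a => g a b - g 0 b) (T := j + n + 1) (by simp)
    (fun a ha => by
      have := hg.concave_answer a b (by omega)
      linarith) (n := n + 1) (p := j + n + 1) (by omega) le_rfl
  have e1 : b + (j + n + 1) + 1 - (j + 1) = b + n + 1 := by omega
  have e2 : b + (j + n + 1) + 1 - (j + 1 + (n + 1)) = b := by omega
  have e3 : j + 1 + (n + 1) - 1 = j + n + 1 := by omega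
  have e4 : b + (j + n + 1) - (j + n + 1) = b := by omega
  have e5 : b + (j + n + 1) - (j + 1) = b + n := by omega
  rw [e1, e2, e3, e4, e5]
  push_cast at h2 ⊢
  have hn0 : (0 : ℝ) < (n : ℝ) + 1 := by positivity
  have hp0 : (0 : ℝ) < (j : ℝ) + n + 1 := by positivity
  have e6 : ((j : ℝ) + 1 + (n + 1) - 1) = j + n + 1 := by ring
  have e7 : ((n : ℝ) + 1 - 1) = n := by ring
  rw [e6, e7]
  have h3 : 1 / ((j : ℝ) + n + 1) * (g (j + n + 1) b - g 0 b) ≤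
      1 / ((n : ℝ) + 1) * (g (n + 1) b - g 0 b) := by
    rw [one_div_mul_eq_div, one_div_mul_eq_div, div_le_div_iff₀ hp0 hn0]
    linarith
  have h4 : (n : ℝ) / (n + 1) * g 0 (b + n + 1) + 1 / ((n : ℝ) + 1) * g (n + 1) b ≤
      g 1 (b + n) := by
    rw [div_mul_eq_mul_div, one_div_mul_eq_div, ← add_div, div_le_iff₀ hn0]
    linarith
  linarith

/-- Han's inequality for the stored contents. -/
lemma stored_div_le (hg : IsProfile N g) {i : ℕ} (hi0 : 1 ≤ i) (hi : i + 1 ≤ N) :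
    g 0 (N + 1 - i) / ((N : ℝ) - i + 1) ≤
      g 0 (N + 1 - (i + 1)) / ((N : ℝ) - (i + 1 : ℕ) + 1) := by
  obtain ⟨l, rfl⟩ : ∃ l, N = i + 1 + l := ⟨N - (i + 1), by omega⟩
  have h := mul_le_mul_of_concave (φ := g 0) (T := i + 1 + l) hg.zero hg.concave_stored
    (n := l + 1) (p := l + 2) (by omega) (by omega)
  have e1 : i + 1 + l + 1 - i = l + 2 := by omega
  have e2 : i + 1 + l + 1 - (i + 1) = l + 1 := by omega
  rw [e1, e2]
  push_cast at h ⊢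
  have e3 : (i : ℝ) + 1 + l - i + 1 = l + 2 := by ring
  have e4 : (i : ℝ) + 1 + l - (i + 1) + 1 = l + 1 := by ring
  rw [e3, e4, div_le_div_iff₀ (by positivity) (by positivity)]
  linarith

end IsProfile

/-! ### The coefficients and the recursive step -/

lemma sum_Icc_succ_bot {j N : ℕ} (h : j ≤ N) (φ : ℕ → ℝ) :
    ∑ i ∈ Icc j N, φ i = φ j + ∑ i ∈ Icc (j + 1) N, φ i := by
  rw [← Finset.insert_Icc_add_one_left_eq_Icc h, Finset.sum_insert (by simp)]

/-- Summation by parts: nonnegative tail sums pair nonnegatively with a nondecreasing nonnegative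
sequence. -/
lemma sum_mul_nonneg_of_tail_nonneg {e y : ℕ → ℝ} {j₀ N : ℕ} (hj₀ : j₀ ≤ N)
    (hy0 : 0 ≤ y j₀) (hy : ∀ i, j₀ ≤ i → i + 1 ≤ N → y i ≤ y (i + 1))
    (he : ∀ j ∈ Icc j₀ N, 0 ≤ ∑ i ∈ Icc j N, e i) : 0 ≤ ∑ i ∈ Icc j₀ N, e i * y i := by
  have key : ∀ d j, j + d = N → j₀ ≤ j →
      y j * ∑ i ∈ Icc j N, e i ≤ ∑ i ∈ Icc j N, e i * y i := by
    intro d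
    induction d with
    | zero =>
      rintro j rfl _
      simp [mul_comm]
    | succ d ih =>
      intro j hj hj0
      have h1 := ih (j + 1) (by omega) (by omega)
      rw [sum_Icc_succ_bot (by omega) e, sum_Icc_succ_bot (by omega) fun i => e i * y i]
      have h2 := mul_le_mul_of_nonneg_right (hy j hj0 (by omega))
        (he (j + 1) (mem_Icc.2 ⟨by omega, by omega⟩))
      linarith
  exact (mul_nonneg hy0 (he j₀ (mem_Icc.2 ⟨le_rfl, hj₀⟩))).trans
    (key (N - j₀) j₀ (by omega) le_rfl)

/-- A single formula for the three ranges of `i`, with indicators in place of `i`-dependent index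
sets, so that sums over `i` and `j` can be exchanged. -/
lemma dCoeff_eq {N m : ℕ} (c : ℕ → ℕ → ℝ) {i : ℕ} (hi : 2 ≤ i) :
    dCoeff N m c i =
      ∑ j ∈ Icc 2 m, (if j < i then c j (i - j) * (1 / ((i : ℝ) - j) - 1 / ((i : ℝ) - 1)) else 0) +
      (if i ≤ m + 1 then c (i - 1) 0 else 0) +
      if i ≤ m then ∑ n ∈ Icc 1 (N + 1 - i), ((n : ℝ) - 1) * c i n / n else 0 := by
  have hall : m < i → (Icc 2 m).filter (fun j => j < i) = Icc 2 m := fun h =>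
    Finset.filter_true_of_mem fun j hj => by
      have := mem_Icc.1 hj
      omega
  rw [← Finset.sum_filter, dCoeff]
  split_ifs with h1 h2 h3 h4 h5
  · congr 2
    refine Finset.sum_congr ?_ fun _ _ => rfl
    ext j
    simp only [mem_Icc, mem_filter]
    omega
  · omega
  · rw [hall (by omega), add_zero, add_comm, h3]
    rfl
  · omega
  · omega
  · rw [hall (by omega), add_zero, add_zero]

lemma IsAdmissible.nonneg {N m : ℕ} {c : ℕ → ℕ → ℝ} (hc : IsAdmissible N m c) (j n : ℕ) :
    0 ≤ c j n := by
  by_cases h : j ∈ Icc 1 m ∧ n ≤ N + 1 - j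
  · exact (hc.mem_unit j h.1 n (mem_Icc.2 ⟨Nat.zero_le _, h.2⟩)).1
  · rw [hc.eq_zero j n h]

/-- Admissibility bounds the tail sums only from `j ≤ m` on; this sign covers the tails beyond `m`.
-/
lemma IsAdmissible.dCoeff_nonneg {N m : ℕ} {c : ℕ → ℕ → ℝ} (hc : IsAdmissible N m c) {i : ℕ}
    (hi : m < i) (hi2 : 2 ≤ i) : 0 ≤ dCoeff N m c i := by
  rw [dCoeff_eq c hi2, if_neg (by omega : ¬ i ≤ m), add_zero]
  refine add_nonneg (Finset.sum_nonneg fun j hj => ?_) ?_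
  · split_ifs with h
    · refine mul_nonneg (hc.nonneg _ _) (sub_nonneg.2 ?_)
      have hj2 : (2 : ℝ) ≤ j := by exact_mod_cast (mem_Icc.1 hj).1
      have hji : (j : ℝ) < i := by exact_mod_cast h
      exact one_div_le_one_div_of_le (by linarith) (by linarith)
    · exact le_rfl
  · split_ifs
    · exact hc.nonneg _ _
    · exact le_rfl

/-- The admissibility constraints allow to exchange the weights `dCoeff` for unit weights. -/
lemma IsAdmissible.sum_stored_le {N m : ℕ} {c : ℕ → ℕ → ℝ} (hc : IsAdmissible N m c)
    (hmN : m + 1 ≤ N) (hm : 2 ≤ m) {g : ℕ → ℕ → ℝ} (hg : IsProfile N g) :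
    ∑ i ∈ Icc 2 m, g 0 (N + 1 - i) ≤ ∑ i ∈ Icc 2 N, dCoeff N m c i * g 0 (N + 1 - i) := by
  have hw : ∀ i ∈ Icc 2 N, (0 : ℝ) < (N : ℝ) - i + 1 := fun i hi => by
    have : (i : ℝ) ≤ N := by exact_mod_cast (mem_Icc.1 hi).2
    linarith
  have hrestrict : ∀ (j : ℕ) (φ : ℕ → ℝ), ∑ i ∈ Icc j N, (if i ≤ m then φ i else 0) =
      ∑ i ∈ Icc j m, φ i := by
    intro j φ
    rw [← Finset.sum_filter]
    refine Finset.sum_congr ?_ fun _ _ => rfl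
    ext i
    simp only [mem_Icc, mem_filter]
    omega
  -- The constraints say that the tail sums of `(N - i + 1) * (d_i - 1_{i ≤ m})` are nonnegative,
  -- and by Han's inequality `g 0 (N + 1 - i) / (N - i + 1)` is nondecreasing in `i`.
  have h := sum_mul_nonneg_of_tail_nonneg (j₀ := 2) (N := N)
    (e := fun i => ((N : ℝ) - i + 1) * dCoeff N m c i - if i ≤ m then (N : ℝ) - i + 1 else 0)
    (y := fun i => g 0 (N + 1 - i) / ((N : ℝ) - i + 1)) (by omega)
    (div_nonneg (hg.nonneg _ _) (hw 2 (mem_Icc.2 ⟨le_rfl, by omega⟩)).le)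
    (fun i h2 hi => hg.stored_div_le (by omega) hi) (fun j hj => by
      rw [Finset.sum_sub_distrib, hrestrict, sub_nonneg]
      by_cases hjm : j ≤ m
      · exact hc.subset_entropy j (mem_Icc.2 ⟨(mem_Icc.1 hj).1, hjm⟩)
      · rw [Finset.Icc_eq_empty (by omega : ¬ j ≤ m), Finset.sum_empty]
        refine Finset.sum_nonneg fun i hi => ?_
        have h1 := mem_Icc.1 hi
        have h2 := mem_Icc.1 hj
        exact mul_nonneg (hw i (mem_Icc.2 ⟨by omega, h1.2⟩)).le
          (hc.dCoeff_nonneg (by omega) (by omega)))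
  rw [← sub_nonneg, ← hrestrict 2 fun i => g 0 (N + 1 - i), ← Finset.sum_sub_distrib]
  refine h.trans_eq (Finset.sum_congr rfl fun i hi => ?_)
  have := hw i hi
  split_ifs
  · field_simp
  · field_simp
    ring

/-- The stored contents collected with the weights `dCoeff`. -/
lemma sum_dCoeff_mul {N m : ℕ} (c : ℕ → ℕ → ℝ) (hmN : m + 1 ≤ N) (x : ℕ → ℝ)
    (hx : x (N + 1) = 0) :
    ∑ i ∈ Icc 2 N, dCoeff N m c i * x i =
      ∑ j ∈ Icc 1 m, c j 0 * x (j + 1) +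
      ∑ j ∈ Icc 2 m, ∑ n ∈ Icc 1 (N + 1 - j), c j n * (((n : ℝ) - 1) / n * x j +
        (1 / (n : ℝ) - 1 / ((j : ℝ) + n - 1)) * x (j + n)) := by
  have h1 : ∀ i ∈ Icc 2 N, dCoeff N m c i * x i =
      (∑ j ∈ Icc 2 m, (if j < i then
        c j (i - j) * (1 / ((i : ℝ) - j) - 1 / ((i : ℝ) - 1)) * x i else 0) +
      (if i ≤ m + 1 then c (i - 1) 0 * x i else 0)) +
      if i ≤ m then ∑ n ∈ Icc 1 (N + 1 - i), c i n * (((n : ℝ) - 1) / n * x i) else 0 := by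
    intro i hi
    rw [dCoeff_eq c (mem_Icc.1 hi).1, add_mul, add_mul, Finset.sum_mul, ite_mul, ite_mul, zero_mul,
      Finset.sum_mul]
    simp only [ite_mul, zero_mul]
    congr 2
    refine Finset.sum_congr rfl fun n _ => ?_
    ring
  rw [Finset.sum_congr rfl h1, Finset.sum_add_distrib, Finset.sum_add_distrib, Finset.sum_comm]
  simp only [mul_add, Finset.sum_add_distrib]
  have hA : ∀ j ∈ Icc 2 m, ∑ i ∈ Icc 2 N, (if j < i then
        c j (i - j) * (1 / ((i : ℝ) - j) - 1 / ((i : ℝ) - 1)) * x i else 0) =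
      ∑ n ∈ Icc 1 (N + 1 - j), c j n * ((1 / (n : ℝ) - 1 / ((j : ℝ) + n - 1)) * x (j + n)) := by
    intro j hj
    have hj' := mem_Icc.1 hj
    -- The top index `n = N + 1 - j` leads to `x (N + 1)`, which has no `d` attached; it is harmless
    -- because that value is `0`.
    have e : N + 1 - j = N - j + 1 := by omega
    rw [e, Finset.sum_Icc_succ_top (by omega)]
    have e' : j + (N - j + 1) = N + 1 := by omega
    rw [e', hx, mul_zero, mul_zero, add_zero, ← Finset.sum_filter]
    refine Finset.sum_nbij' (fun i => i - j) (fun n => j + n) ?_ ?_ ?_ ?_ ?_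
    · intro i hi
      simp only [mem_filter, mem_Icc] at hi ⊢
      omega
    · intro i hi
      simp only [mem_filter, mem_Icc] at hi ⊢
      omega
    · intro i hi
      simp only [mem_filter, mem_Icc] at hi
      omega
    · intro n _
      omega
    · intro i hi
      simp only [mem_filter, mem_Icc] at hi
      have e1 : j + (i - j) = i := by omega
      rw [e1, Nat.cast_sub (by omega)]
      ring
  have hB : ∑ i ∈ Icc 2 N, (if i ≤ m + 1 then c (i - 1) 0 * x i else 0) =
      ∑ j ∈ Icc 1 m, c j 0 * x (j + 1) := by
    rw [← Finset.sum_filter]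
    refine Finset.sum_nbij' (fun i => i - 1) (fun n => n + 1) ?_ ?_ ?_ ?_ ?_
    · intro i hi
      simp only [mem_filter, mem_Icc] at hi ⊢
      omega
    · intro i hi
      simp only [mem_filter, mem_Icc] at hi ⊢
      omega
    · intro i hi
      simp only [mem_filter, mem_Icc] at hi
      omega
    · intro n _
      omega
    · intro i hi
      simp only [mem_filter, mem_Icc] at hi
      rw [Nat.sub_add_cancel (by omega)]
  have hD : ∑ i ∈ Icc 2 N, (if i ≤ m then
        ∑ n ∈ Icc 1 (N + 1 - i), c i n * (((n : ℝ) - 1) / n * x i) else 0) =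
      ∑ j ∈ Icc 2 m, ∑ n ∈ Icc 1 (N + 1 - j), c j n * (((n : ℝ) - 1) / n * x j) := by
    rw [← Finset.sum_filter]
    refine Finset.sum_congr ?_ fun _ _ => rfl
    ext i
    simp only [mem_Icc, mem_filter]
    omega
  rw [Finset.sum_congr rfl hA, hB, hD]
  ring

/-- `chain` with `b = N - m`, reindexed by `j = m - a`; its leading term `g 0 (N - m)` cancels the
subtracted term at `i = m + 1`. -/
lemma IsProfile.sum_answer_sub_le {N m : ℕ} {g : ℕ → ℕ → ℝ} (hg : IsProfile N g) (hm : m ≤ N)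
    (hm1 : 1 ≤ m) :
    ∑ j ∈ Icc 1 m, g 1 (N - j) - ∑ i ∈ Icc 2 m, g 0 (N + 1 - i) ≤ g m (N - m) := by
  have h := hg.chain (m := m) (b := N - m) (by omega)
  refine le_trans (le_of_eq ?_) h
  have h1 : ∑ a ∈ range m, g 1 (a + (N - m)) = ∑ j ∈ Icc 1 m, g 1 (N - j) := by
    refine Finset.sum_nbij' (fun a => m - a) (fun j => m - j) ?_ ?_ ?_ ?_ ?_ <;> intro a ha <;>
      simp only [mem_range, mem_Icc] at ha ⊢
    · omega
    · omega
    · omega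
    · omega
    · congr 1
      omega
  have h2 : ∑ a ∈ range m, g 0 (a + (N - m)) = ∑ i ∈ Icc 2 (m + 1), g 0 (N + 1 - i) := by
    refine Finset.sum_nbij' (fun a => m + 1 - a) (fun j => m + 1 - j) ?_ ?_ ?_ ?_ ?_ <;>
      intro a ha <;> simp only [mem_range, mem_Icc] at ha ⊢
    · omega
    · omega
    · omega
    · omega
    · congr 1
      omega
  rw [Finset.sum_sub_distrib, h1, h2, Finset.sum_Icc_succ_top (by omega)]
  have : N + 1 - (m + 1) = N - m := by omega
  rw [this]
  ring

/-- The recursive step: `g` and `g'` are the profiles for two different desired messages. -/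
lemma IsAdmissible.recursion {N m : ℕ} {c : ℕ → ℕ → ℝ} (hc : IsAdmissible N m c)
    (hmN : m + 1 ≤ N) (hm : 2 ≤ m) {g g' : ℕ → ℕ → ℝ} (hg : IsProfile N g) (hg' : IsProfile N g')
    (h0 : ∀ b ≤ N, g 0 b = g' 0 b) (h1 : ∀ b, b + 1 ≤ N → g 1 b = g' 1 b) :
    c 1 1 * g' 1 (N - 1) + ∑ j ∈ Icc 2 m, ∑ n ∈ Icc 1 (N + 1 - j),
      c j n / ((j : ℝ) + n - 1) * g' (j + n - 1) (N - (j + n - 1)) ≤ g m (N - m) := by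
  have hsum := hg.sum_answer_sub_le (m := m) (by omega) (by omega)
  -- All terms of the chain bound involve at most one answer, so `g` can be replaced by `g'`.
  have e1 : ∑ j ∈ Icc 1 m, g 1 (N - j) = ∑ j ∈ Icc 1 m, g' 1 (N - j) :=
    Finset.sum_congr rfl fun j hj => h1 _ (by have := mem_Icc.1 hj; omega)
  have e0 : ∑ i ∈ Icc 2 m, g 0 (N + 1 - i) = ∑ i ∈ Icc 2 m, g' 0 (N + 1 - i) :=
    Finset.sum_congr rfl fun j hj => h0 _ (by have := mem_Icc.1 hj; omega)
  rw [e1, e0] at hsum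
  have hst := hc.sum_stored_le hmN hm hg'
  rw [sum_dCoeff_mul c hmN (fun i => g' 0 (N + 1 - i)) (by simpa using hg'.zero)] at hst
  have hsplit : ∀ j ∈ Icc 1 m, g' 1 (N - j) =
      c j 0 * g' 1 (N - j) + ∑ n ∈ Icc 1 (N + 1 - j), c j n * g' 1 (N - j) := by
    intro j hj
    rw [← sum_Icc_succ_bot (Nat.zero_le _) fun n => c j n * g' 1 (N - j), ← Finset.sum_mul,
      hc.sum_eq_one j hj, one_mul]
  have hzero : ∀ j ∈ Icc 1 m, c j 0 * g' 0 (N + 1 - (j + 1)) ≤ c j 0 * g' 1 (N - j) := by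
    intro j hj
    have hj' := mem_Icc.1 hj
    have e : N + 1 - (j + 1) = N - j := by omega
    rw [e]
    exact mul_le_mul_of_nonneg_left (hg'.le_answer _ (by omega)) (hc.nonneg _ _)
  -- For `j = 1` the terms with `n ≥ 2` are discarded by nonnegativity, since `c_1^n` with `n ≥ 2`
  -- enters neither `d` nor the recursion.
  have hfirst : c 1 0 * g' 0 (N + 1 - (1 + 1)) + c 1 1 * g' 1 (N - 1) ≤ g' 1 (N - 1) := by
    have hmem : 1 ∈ Icc 1 m := mem_Icc.2 ⟨le_rfl, by omega⟩
    have h2 : c 1 1 * g' 1 (N - 1) ≤ ∑ n ∈ Icc 1 (N + 1 - 1), c 1 n * g' 1 (N - 1) :=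
      Finset.single_le_sum (f := fun n => c 1 n * g' 1 (N - 1))
        (fun n _ => mul_nonneg (hc.nonneg _ _) (hg'.nonneg _ _)) (mem_Icc.2 ⟨le_rfl, by omega⟩)
    have h3 := hsplit 1 hmem
    have h4 := hzero 1 hmem
    linarith
  -- For `j ≥ 2`, `window` is used with weight `c_j^n` for every `n ≥ 1`. The content terms on the
  -- left are those collected by `sum_dCoeff_mul`.
  have hother : ∀ j ∈ Icc 2 m, c j 0 * g' 0 (N + 1 - (j + 1)) +
      (∑ n ∈ Icc 1 (N + 1 - j), c j n * (((n : ℝ) - 1) / n * g' 0 (N + 1 - j) +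
        (1 / (n : ℝ) - 1 / ((j : ℝ) + n - 1)) * g' 0 (N + 1 - (j + n))) +
      ∑ n ∈ Icc 1 (N + 1 - j),
        c j n / ((j : ℝ) + n - 1) * g' (j + n - 1) (N - (j + n - 1))) ≤ g' 1 (N - j) := by
    intro j hj
    have hj' := mem_Icc.1 hj
    have hmem : j ∈ Icc 1 m := mem_Icc.2 ⟨by omega, hj'.2⟩
    rw [hsplit j hmem]
    refine add_le_add (hzero j hmem) ?_
    rw [← Finset.sum_add_distrib]
    refine Finset.sum_le_sum fun n hn => ?_
    have hn' := mem_Icc.1 hn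
    have hw := mul_le_mul_of_nonneg_left
      (hg'.window (j := j) (n := n) (by omega) hn'.1 (by omega)) (hc.nonneg j n)
    refine le_trans (le_of_eq ?_) hw
    ring
  have htot := Finset.sum_le_sum hother
  rw [Finset.sum_add_distrib, Finset.sum_add_distrib] at htot
  rw [sum_Icc_succ_bot (by omega) fun j => g' 1 (N - j)] at hsum
  rw [sum_Icc_succ_bot (by omega) fun j => c j 0 * g' 0 (N + 1 - (j + 1))] at hst
  norm_num only at hst hsum htot hfirst ⊢
  linarith

/-! ### Profiles of a code and the induction on the messages -/

namespace Code

variable {N K : ℕ} (C : Code N K)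

/-- The symmetrized entropies of a code. -/
def symEntropy (k : Fin K) (t : ℕ) : (Fin N → Fin 3) → ℝ := symmetrize (C.levelEntropy k t)

lemma isSymSubmodular_symEntropy (k : Fin K) (t : ℕ) : IsSymSubmodular (C.symEntropy k t) :=
  isSymSubmodular_symmetrize (C.levelEntropy_mono k t) (C.levelEntropy_submodular k t)

/-- Averaged entropies of `a` answers and `b` stored contents given the first `t` messages, in
units of one message. -/
def condProfile (k : Fin K) (t a b : ℕ) : ℝ :=
  (profile (C.symEntropy k t) a b - t * C.msgEntropy) / C.msgEntropy

lemma profile_symEntropy_bot (k : Fin K) {t : ℕ} (ht : t ≤ K) :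
    profile (C.symEntropy k t) 0 0 = t * C.msgEntropy := by
  rw [← (C.isSymSubmodular_symEntropy k t).eq_profile (P := ∅) (R := ∅) (by simp)
    Finset.card_empty Finset.card_empty]
  refine symmetrize_eq_of_forall fun σ => ?_
  rw [ind_comp_perm, Finset.map_empty, C.levelEntropy_bot k ht]

lemma isProfile_condProfile (k : Fin K) {t : ℕ} (ht : t ≤ K) :
    IsProfile N (C.condProfile k t) := by
  have hs := C.isSymSubmodular_symEntropy k t
  have hp := C.msgEntropy_pos
  have h0 := C.profile_symEntropy_bot k ht
  constructor
  · simp [condProfile, h0]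
  · intro a b
    refine div_nonneg (sub_nonneg.2 ?_) hp.le
    rw [← h0]
    exact hs.profile_bot_le a b
  · intro b hb
    exact div_le_div_of_nonneg_right (sub_le_sub_right (hs.profile_mono_answer hb) _) hp.le
  · intro a b h
    unfold condProfile
    rw [← add_div, ← add_div]
    refine div_le_div_of_nonneg_right ?_ hp.le
    linarith [hs.answer_after_answers h]
  · intro n b h
    unfold condProfile
    rw [← add_div, ← add_div]
    refine div_le_div_of_nonneg_right ?_ hp.le
    linarith [hs.answer_exchange h]
  · intro a b h
    unfold condProfile
    rw [← add_div, mul_div_assoc']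
    refine div_le_div_of_nonneg_right ?_ hp.le
    linarith [hs.concave_answer h]
  · intro b h
    unfold condProfile
    rw [← add_div, mul_div_assoc']
    refine div_le_div_of_nonneg_right ?_ hp.le
    linarith [hs.concave_stored h]

lemma condProfile_privacy (k k' : Fin K) (t : ℕ) {a : ℕ} (ha : a ≤ 1) (hN : 0 < N) (b : ℕ) :
    C.condProfile k t a b = C.condProfile k' t a b := by
  unfold condProfile profile symEntropy symmetrize
  congr 4
  funext σ
  -- With `a ≤ 1`, only the server that `σ` moves to position `0` can have level `1`.
  refine C.levelEntropy_privacy k k' t (σ.symm ⟨0, hN⟩) fun n hn h1 => hn ?_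
  rw [Function.comp_apply, ind_eq_one, mem_filter] at h1
  rw [Equiv.eq_symm_apply]
  exact Fin.ext (by simp only; omega)

/-- When `a + b = N`, no server is left at level `0`. The `1` is the message that moves into the
conditioning. -/
lemma condProfile_decode (k : Fin K) {a b : ℕ} (hab : a + b = N) :
    1 + C.condProfile k (k + 1) a b ≤ C.condProfile k k a b := by
  have hp := C.msgEntropy_pos
  have h : profile (C.symEntropy k (k + 1)) a b ≤ profile (C.symEntropy k k) a b := by
    refine symmetrize_le fun σ => C.levelEntropy_decode k fun n h0 => ?_
    have hlt := (σ n).isLt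
    by_cases hlt' : (σ n : ℕ) < a
    · simp [ind, hlt'] at h0
    · simp [ind, hlt', hab, not_lt.1 hlt'] at h0
  unfold condProfile
  rw [← sub_nonneg]
  have e : (profile (C.symEntropy k k) a b - (k : ℕ) * C.msgEntropy) / C.msgEntropy -
      (1 + (profile (C.symEntropy k (k + 1)) a b - ((k + 1 : ℕ) : ℝ) * C.msgEntropy) /
        C.msgEntropy) =
      (profile (C.symEntropy k k) a b - profile (C.symEntropy k (k + 1)) a b) / C.msgEntropy := by
    push_cast
    field_simp
    ring
  rw [e]
  exact div_nonneg (sub_nonneg.2 h) hp.le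

end Code

lemma tildeB_one (N : ℕ) (c : ℕ → ℕ → ℕ → ℕ → ℝ) (k : ℕ) :
    tildeB N c (k + 1) 1 = ((k + 1 : ℕ) : ℝ) := by
  cases k with
  | zero => simp [tildeB]
  | succ k => simp [tildeB, add_assoc, one_add_one_eq_two]

lemma tildeB_self {N : ℕ} (hN : 2 ≤ N) (c : ℕ → ℕ → ℕ → ℕ → ℝ) (k : ℕ) :
    tildeB N c (k + 1) N = N * beta0 N (k + 1) := by
  have h1 : N ≠ 1 := by omega
  have h0 : (N : ℝ) ≠ 0 := by positivity
  cases k with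
  | zero => simp [tildeB, beta0, h0]
  | succ k => simp [tildeB, h1]

lemma beta0_succ {N : ℕ} (hN : 0 < N) (k : ℕ) :
    N * beta0 N (k + 1) = 1 + (N * beta0 N k) / N := by
  have h0 : (N : ℝ) ≠ 0 := by positivity
  unfold beta0
  rw [sum_Icc_succ_bot (by omega), mul_div_cancel_left₀ _ h0, mul_add, pow_one,
    mul_one_div_cancel h0, Finset.mul_sum]
  congr 1
  refine (Finset.sum_nbij' (fun i => i + 1) (fun i => i - 1) ?_ ?_ ?_ ?_ ?_).symm
  · intro i hi
    simp only [mem_Icc] at hi ⊢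
    omega
  · intro i hi
    simp only [mem_Icc] at hi ⊢
    omega
  · intro i _
    omega
  · intro i hi
    simp only [mem_Icc] at hi
    omega
  · intro i _
    rw [pow_succ]
    field_simp

/-- The recursively defined bound holds for every code. -/
lemma Code.tildeB_le_condProfile {N K : ℕ} (C : Code N K) (hN : 2 ≤ N)
    {c : ℕ → ℕ → ℕ → ℕ → ℝ} (hc : c ∈ Coeffs N K) (k : ℕ) :
    ∀ κ : Fin K, (κ : ℕ) + (k + 1) = K → ∀ m ∈ Icc 1 N,
      tildeB N c (k + 1) m ≤ C.condProfile κ κ m (N - m) := by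
  -- `k + 1` counts the messages still unknown, `κ` being the first of them; the base case is the
  -- last message.
  induction k with
  | zero =>
    intro κ hκ m hm
    have hm' := mem_Icc.1 hm
    have h1 := C.condProfile_decode κ (a := m) (b := N - m) (by omega)
    have h2 := (C.isProfile_condProfile κ (t := κ + 1) (by omega)).nonneg m (N - m)
    simp only [tildeB]
    linarith
  | succ k ih =>
    intro κ hκ m hm
    have hm' := mem_Icc.1 hm
    obtain ⟨κ', hκ'⟩ : ∃ κ' : Fin K, (κ' : ℕ) = κ + 1 := ⟨⟨κ + 1, by omega⟩, rfl⟩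
    have hdec := C.condProfile_decode κ (a := m) (b := N - m) (by omega)
    have hg := C.isProfile_condProfile κ (t := κ + 1) (by omega)
    have hg' := C.isProfile_condProfile κ' (t := κ + 1) (by omega)
    have h0 : ∀ b, C.condProfile κ (κ + 1) 0 b = C.condProfile κ' (κ + 1) 0 b := fun b =>
      C.condProfile_privacy κ κ' _ zero_le_one (by omega) b
    have h1 : ∀ b, C.condProfile κ (κ + 1) 1 b = C.condProfile κ' (κ + 1) 1 b := fun b =>
      C.condProfile_privacy κ κ' _ le_rfl (by omega) b
    have hih : ∀ p ∈ Icc 1 N, tildeB N c (k + 1) p ≤ C.condProfile κ' (κ + 1) p (N - p) := by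
      intro p hp
      rw [← hκ']
      exact ih κ' (by omega) p hp
    refine le_trans ?_ hdec
    by_cases hm1 : m = 1
    · subst hm1
      have h2 := hih 1 hm
      rw [tildeB_one] at h2 ⊢
      rw [h1]
      push_cast at h2 ⊢
      linarith
    by_cases hmN : m = N
    · subst hmN
      have h2 := hih m hm
      rw [tildeB_self hN] at h2 ⊢
      rw [beta0_succ (by omega)]
      rw [Nat.sub_self] at h2 ⊢
      -- The case `m = N` is the chain `g N 0 ≥ g 1 0 = g' 1 0 ≥ g' N 0 / N`: the first step keeps
      -- only the term `a = 0` of `chain`, the second is privacy, the third is Han's inequality.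
      have h3 := mul_le_mul_of_concave (φ := fun a => C.condProfile κ' (κ + 1) a 0) (T := m)
        hg'.zero (fun a ha => hg'.concave_answer a 0 (by omega)) (n := 1) (p := m) (by omega)
        le_rfl
      have h4 := hg.chain (m := m) (b := 0) (by omega)
      have h5 := Finset.single_le_sum
        (f := fun a => C.condProfile κ (κ + 1) 1 (a + 0) - C.condProfile κ (κ + 1) 0 (a + 0))
        (fun a ha => sub_nonneg.2 (hg.le_answer _ (by have := mem_range.1 ha; omega)))
        (mem_range.2 (by omega : 0 < m))
      have hz := hg.zero
      have hN0 : (0 : ℝ) < m := by exact_mod_cast hm'.1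
      have h6 : (m * beta0 m (k + 1)) / m ≤ C.condProfile κ' (κ + 1) 1 0 := by
        rw [div_le_iff₀ hN0]
        push_cast at h3
        linarith
      have h7 := h1 0
      simp only [add_zero] at h4 h5
      linarith
    · have hadm := hc (k + 2) (mem_Icc.2 ⟨by omega, by omega⟩) m (mem_Icc.2 ⟨by omega, by omega⟩)
      have hrec := hadm.recursion (by omega) (by omega) hg hg' (fun b _ => h0 b) fun b _ => h1 b
      have hfirst := mul_le_mul_of_nonneg_left (hih 1 (mem_Icc.2 ⟨le_rfl, by omega⟩))
        (hadm.nonneg 1 1)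
      rw [tildeB_one] at hfirst
      have hsum : ∑ j ∈ Icc 2 m, ∑ n ∈ Icc 1 (N + 1 - j),
          c (k + 2) m j n / ((j : ℝ) + n - 1) * tildeB N c (k + 1) (j + n - 1) ≤
          ∑ j ∈ Icc 2 m, ∑ n ∈ Icc 1 (N + 1 - j), c (k + 2) m j n / ((j : ℝ) + n - 1) *
            C.condProfile κ' (κ + 1) (j + n - 1) (N - (j + n - 1)) := by
        refine Finset.sum_le_sum fun j hj => Finset.sum_le_sum fun n hn => ?_
        have hj' := mem_Icc.1 hj
        have hn' := mem_Icc.1 hn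
        refine mul_le_mul_of_nonneg_left (hih _ (mem_Icc.2 ⟨by omega, by omega⟩))
          (div_nonneg (hadm.nonneg _ _) ?_)
        have : (2 : ℝ) ≤ j := by exact_mod_cast hj'.1
        have : (0 : ℝ) ≤ n := Nat.cast_nonneg n
        linarith
      rw [tildeB, if_neg hm1, if_neg hmN]
      have e : (((k + 2 : ℕ) : ℝ) - 1) = ((k + 1 : ℕ) : ℝ) := by push_cast; ring
      rw [e]
      linarith

lemma Code.tildeB_le_info {N K : ℕ} (C : Code N K) (hN : 2 ≤ N) (hK : 0 < K)
    {c : ℕ → ℕ → ℕ → ℕ → ℝ} (hc : c ∈ Coeffs N K) {m : ℕ} (hm : m ∈ Icc 1 N) :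
    tildeB N c K m ≤ ((N : ℝ) - m) * C.infoStorage + m * C.infoDownload ⟨0, hK⟩ := by
  have hm' := mem_Icc.1 hm
  have hN0 : (0 : ℝ) < N := by exact_mod_cast (by omega : 0 < N)
  have hp := C.msgEntropy_pos
  obtain ⟨k, rfl⟩ : ∃ k, K = k + 1 := ⟨K - 1, by omega⟩
  have h1 := C.tildeB_le_condProfile hN hc k ⟨0, hK⟩ (by simp) m hm
  have hs := C.isSymSubmodular_symEntropy ⟨0, hK⟩ 0
  -- Nothing is conditioned on when `t = 0`, and the single-server averages in the subadditive bound
  -- are exactly the informational costs up to normalization.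
  have h2 := hs.profile_subadditive
    (by simpa using C.profile_symEntropy_bot ⟨0, hK⟩ (Nat.zero_le _)) (a := m) (b := N - m)
    (by omega)
  rw [C.infoStorage_eq ⟨0, hK⟩, C.infoDownload_eq, ← card_mul_profile_answer hs,
    ← card_mul_profile_stored hs, mul_div_mul_left _ _ hN0.ne', mul_div_mul_left _ _ hN0.ne',
    mul_div_assoc', mul_div_assoc', ← add_div]
  refine h1.trans ?_
  unfold condProfile
  rw [Nat.cast_zero, zero_mul, sub_zero]
  refine div_le_div_of_nonneg_right (h2.trans_eq ?_) hp.le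
  rw [Nat.cast_sub hm'.2]
  unfold symEntropy
  ring

/-! ### From codes to the infima -/

/-- The code that stores and downloads everything at every server. -/
def trivialCode (N K : ℕ) (hN : 0 < N) : Code N K where
  X := Bool
  L := 1
  L_pos := one_pos
  S _ := Fin K → Fin 1 → Bool
  store _ w := w
  F := Unit
  key := PMF.pure ()
  Q _ := Unit
  query _ _ _ := ()
  Y := Fin K → Fin 1 → Bool
  len _ _ := 1
  answer _ _ s := [s]
  length_answer _ _ _ := rfl
  decode k a _ := (a ⟨0, hN⟩).headD default k
  correct _ _ _ _ := rfl
  privacy _ _ _ := rfl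

lemma opAchievable_infoAchievable {N K : ℕ} (hK : 0 < K) {α β : ℝ} (h : OpAchievable N K α β) :
    InfoAchievable N K α β := by
  obtain ⟨C, hC, hα, hβ⟩ := h
  exact ⟨C, (C.infoStorage_le_opStorage ⟨0, hK⟩).trans hα,
    fun k => (C.infoDownload_le_opDownload hC k).trans (hβ k)⟩

/-- Needed because the real `sInf` of the empty set is `0`, so a bound valid for every code passes
to the infimum only if some pair is achievable. -/
lemma exists_opAchievable (N K : ℕ) (hN : 0 < N) : ∃ α β, OpAchievable N K α β := by
  refine ⟨(trivialCode N K hN).opStorage, ∑ k, |(trivialCode N K hN).opDownload k|,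
    trivialCode N K hN, fun k n => ?_, le_rfl, fun k => ?_⟩
  · have : Finite (trivialCode N K hN).F := inferInstanceAs (Finite Unit)
    exact Summable.of_finite
  · exact (le_abs_self _).trans (Finset.single_le_sum
      (f := fun k => |(trivialCode N K hN).opDownload k|) (fun _ _ => abs_nonneg _) (mem_univ k))

lemma tildeB_le_of_infoAchievable {N K : ℕ} (hN : 2 ≤ N) (hK : 0 < K)
    {c : ℕ → ℕ → ℕ → ℕ → ℝ} (hc : c ∈ Coeffs N K) {m : ℕ} (hm : m ∈ Icc 1 N) {α β : ℝ}
    (h : InfoAchievable N K α β) : tildeB N c K m ≤ ((N : ℝ) - m) * α + m * β := by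
  obtain ⟨C, hα, hβ⟩ := h
  refine (C.tildeB_le_info hN hK hc hm).trans ?_
  have : (m : ℝ) ≤ N := by exact_mod_cast (mem_Icc.1 hm).2
  exact add_le_add (mul_le_mul_of_nonneg_left hα (by linarith))
    (mul_le_mul_of_nonneg_left (hβ _) (Nat.cast_nonneg m))

lemma tildeB_le_infoB {N K : ℕ} (hN : 2 ≤ N) (hK : 0 < K) {c : ℕ → ℕ → ℕ → ℕ → ℝ}
    (hc : c ∈ Coeffs N K) {m : ℕ} (hm : m ∈ Icc 1 N) : tildeB N c K m ≤ infoB N K m := by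
  obtain ⟨α, β, h⟩ := exists_opAchievable N K (by omega)
  refine le_csInf ⟨_, α, β, opAchievable_infoAchievable hK h, rfl⟩ ?_
  rintro x ⟨α, β, h, rfl⟩
  exact tildeB_le_of_infoAchievable hN hK hc hm h

lemma tildeB_le_opB {N K : ℕ} (hN : 2 ≤ N) (hK : 0 < K) {c : ℕ → ℕ → ℕ → ℕ → ℝ}
    (hc : c ∈ Coeffs N K) {m : ℕ} (hm : m ∈ Icc 1 N) : tildeB N c K m ≤ opB N K m := by
  obtain ⟨α, β, h⟩ := exists_opAchievable N K (by omega)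
  refine le_csInf ⟨_, α, β, h, rfl⟩ ?_
  rintro x ⟨α, β, h, rfl⟩
  exact tildeB_le_of_infoAchievable hN hK hc hm (opAchievable_infoAchievable hK h)

/-! ### Existence of the maximum -/

lemma continuous_dCoeff (N m i : ℕ) : Continuous fun c : ℕ → ℕ → ℝ => dCoeff N m c i := by
  unfold dCoeff
  split_ifs <;> fun_prop

lemma isClosed_isAdmissible (N m : ℕ) : IsClosed {c : ℕ → ℕ → ℝ | IsAdmissible N m c} := by
  have h : {c : ℕ → ℕ → ℝ | IsAdmissible N m c} =
      {c | ∀ j n, ¬ (j ∈ Icc 1 m ∧ n ≤ N + 1 - j) → c j n = 0} ∩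
      {c | ∀ j ∈ Icc 1 m, ∑ n ∈ Icc 0 (N + 1 - j), c j n = 1} ∩
      {c | ∀ j ∈ Icc 1 m, ∀ n ∈ Icc 0 (N + 1 - j), 0 ≤ c j n ∧ c j n ≤ 1} ∩
      {c | ∀ j ∈ Icc 2 m, ∑ i ∈ Icc j m, ((N : ℝ) - i + 1) ≤
        ∑ i ∈ Icc j N, ((N : ℝ) - i + 1) * dCoeff N m c i} := by
    ext c
    exact ⟨fun h => ⟨⟨⟨h.1, h.2⟩, h.3⟩, h.4⟩, fun ⟨⟨⟨h1, h2⟩, h3⟩, h4⟩ => ⟨h1, h2, h3, h4⟩⟩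
  have hd := continuous_dCoeff N m
  rw [h]
  simp only [Set.ofPred_forall, Set.ofPred_and]
  refine ((IsClosed.inter ?_ ?_).inter ?_).inter ?_
  · exact isClosed_iInter fun j => isClosed_iInter fun n => isClosed_iInter fun _ =>
      isClosed_eq (by fun_prop) (by fun_prop)
  · exact isClosed_iInter fun j => isClosed_iInter fun _ =>
      isClosed_eq (by fun_prop) (by fun_prop)
  · exact isClosed_iInter fun j => isClosed_iInter fun _ => isClosed_iInter fun n =>
      isClosed_iInter fun _ => (isClosed_le (by fun_prop) (by fun_prop)).inter
        (isClosed_le (by fun_prop) (by fun_prop))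
  · exact isClosed_iInter fun j => isClosed_iInter fun _ =>
      isClosed_le (by fun_prop) (by fun_prop)

lemma continuous_tildeB (N K m : ℕ) :
    Continuous fun c : ℕ → ℕ → ℕ → ℕ → ℝ => tildeB N c K m := by
  induction K generalizing m with
  | zero => exact continuous_const
  | succ K ih =>
    cases K with
    | zero => exact continuous_const
    | succ K =>
      simp only [tildeB]
      split_ifs
      · exact continuous_const
      · exact continuous_const
      · fun_prop

/-- Coefficients outside the range of the recursion are never read, so setting them to zero changes
no value. -/
lemma tildeB_congr {N K : ℕ} {c c' : ℕ → ℕ → ℕ → ℕ → ℝ}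
    (h : ∀ k ∈ Icc 2 K, ∀ m ∈ Icc 2 (N - 1), c k m = c' k m) {k : ℕ} (hk : k ≤ K) {m : ℕ}
    (hm : m ∈ Icc 1 N) : tildeB N c k m = tildeB N c' k m := by
  induction k generalizing m with
  | zero => rfl
  | succ k ih =>
    cases k with
    | zero => rfl
    | succ k =>
      have hm' := mem_Icc.1 hm
      simp only [tildeB]
      split_ifs with h1 h2
      · rfl
      · rfl
      · rw [h (k + 2) (mem_Icc.2 ⟨by omega, hk⟩) m (mem_Icc.2 ⟨by omega, by omega⟩)]
        congr 1
        refine Finset.sum_congr rfl fun j hj => Finset.sum_congr rfl fun n hn => ?_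
        have hj' := mem_Icc.1 hj
        have hn' := mem_Icc.1 hn
        rw [ih (by omega) (mem_Icc.2 ⟨by omega, by omega⟩)]

/-- The coefficient vector with `c_j^0 = 1` is admissible. -/
lemma exists_isAdmissible {N m : ℕ} (hmN : m + 1 ≤ N) : ∃ c, IsAdmissible N m c := by
  have hmem : ∀ j n : ℕ, j ∈ Icc 1 m → ((if j ∈ Icc 1 m ∧ n = 0 then 1 else 0 : ℝ) =
      if n = 0 then 1 else 0) := fun j n hj => by simp only [hj, true_and]
  refine ⟨fun j n => if j ∈ Icc 1 m ∧ n = 0 then 1 else 0, ?_, ?_, ?_, ?_⟩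
  · intro j n h
    rw [if_neg]
    rintro ⟨h1, rfl⟩
    exact h ⟨h1, Nat.zero_le _⟩
  · intro j hj
    simp only [hmem j _ hj]
    simp
  · intro j hj n _
    split_ifs <;> norm_num
  · intro j hj
    have hj' := mem_Icc.1 hj
    -- With all weight on `n = 0` one gets `d_i = 1` up to `i = m + 1` and `0` beyond; the term `i =
    -- m + 1` is slack in the constraints.
    have hd : ∀ i, 2 ≤ i → dCoeff N m (fun j n => if j ∈ Icc 1 m ∧ n = 0 then 1 else 0) i =
        if i ≤ m + 1 then 1 else 0 := by
      intro i hi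
      rw [dCoeff_eq _ hi, Finset.sum_eq_zero, zero_add]
      · have h2 : (if i ≤ m then ∑ n ∈ Icc 1 (N + 1 - i), ((n : ℝ) - 1) *
            (if i ∈ Icc 1 m ∧ n = 0 then 1 else 0) / n else 0) = 0 := by
          split_ifs
          · refine Finset.sum_eq_zero fun n hn => ?_
            have hn' := mem_Icc.1 hn
            rw [if_neg (by omega)]
            simp
          · rfl
        rw [h2, add_zero]
        by_cases hi' : i ≤ m + 1
        · rw [if_pos hi', if_pos hi', if_pos ⟨mem_Icc.2 ⟨by omega, by omega⟩, rfl⟩]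
        · rw [if_neg hi', if_neg hi']
      · intro l _
        by_cases h1 : l < i
        · rw [if_pos h1, if_neg (by omega), zero_mul]
        · rw [if_neg h1]
    have hsub : Icc j m ⊆ Icc j N := Finset.Icc_subset_Icc_right (by omega)
    have heq : ∀ i ∈ Icc j m, ((N : ℝ) - i + 1) = ((N : ℝ) - i + 1) *
        dCoeff N m (fun j n => if j ∈ Icc 1 m ∧ n = 0 then 1 else 0) i := by
      intro i hi
      have hi' := mem_Icc.1 hi
      rw [hd i (by omega), if_pos (by omega), mul_one]
    rw [Finset.sum_congr rfl heq]
    refine Finset.sum_le_sum_of_subset_of_nonneg hsub fun i hi _ => ?_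
    have hi' := mem_Icc.1 hi
    have hiN : (i : ℝ) ≤ N := by exact_mod_cast hi'.2
    rw [hd i (by omega)]
    refine mul_nonneg (by linarith) ?_
    split_ifs <;> norm_num

/-- The coefficients that vanish wherever the recursion does not use them. -/
def truncatedCoeffs (N K : ℕ) : Set (ℕ → ℕ → ℕ → ℕ → ℝ) :=
  {c | ∀ k m, (k ∈ Icc 2 K ∧ m ∈ Icc 2 (N - 1) → IsAdmissible N m (c k m)) ∧
    (¬ (k ∈ Icc 2 K ∧ m ∈ Icc 2 (N - 1)) → c k m = 0)}

lemma truncatedCoeffs_subset (N K : ℕ) : truncatedCoeffs N K ⊆ Coeffs N K :=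
  fun _ hc k hk m hm => (hc k m).1 ⟨hk, hm⟩

lemma IsAdmissible.mem_Icc_zero_one {N m : ℕ} {c : ℕ → ℕ → ℝ} (hc : IsAdmissible N m c)
    (j n : ℕ) : c j n ∈ Set.Icc (0 : ℝ) 1 := by
  by_cases h : j ∈ Icc 1 m ∧ n ≤ N + 1 - j
  · exact hc.mem_unit j h.1 n (mem_Icc.2 ⟨Nat.zero_le _, h.2⟩)
  · rw [hc.eq_zero j n h]
    simp

/-- `Coeffs N K` leaves the unused entries free and is therefore unbounded. After truncation it is a
closed subset of a product of unit intervals, compact by Tychonoff. -/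
lemma isCompact_truncatedCoeffs (N K : ℕ) : IsCompact (truncatedCoeffs N K) := by
  have hbox : IsCompact (Set.pi Set.univ fun _ : ℕ => Set.pi Set.univ fun _ : ℕ =>
      Set.pi Set.univ fun _ : ℕ => Set.pi Set.univ fun _ : ℕ => Set.Icc (0 : ℝ) 1) :=
    isCompact_univ_pi fun _ => isCompact_univ_pi fun _ => isCompact_univ_pi fun _ =>
      isCompact_univ_pi fun _ => isCompact_Icc
  refine hbox.of_isClosed_subset ?_ ?_
  · have h : truncatedCoeffs N K = ⋂ k, ⋂ m,
        (⋂ _ : k ∈ Icc 2 K ∧ m ∈ Icc 2 (N - 1),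
          (fun c : ℕ → ℕ → ℕ → ℕ → ℝ => c k m) ⁻¹' {c | IsAdmissible N m c}) ∩
        ⋂ _ : ¬ (k ∈ Icc 2 K ∧ m ∈ Icc 2 (N - 1)),
          (fun c : ℕ → ℕ → ℕ → ℕ → ℝ => c k m) ⁻¹' {0} := by
      ext c
      simp only [truncatedCoeffs, Set.mem_ofPred_eq, Set.mem_iInter, Set.mem_inter_iff,
        Set.mem_preimage, Set.mem_singleton_iff]
    rw [h]
    have hcont : ∀ k m, Continuous fun c : ℕ → ℕ → ℕ → ℕ → ℝ => c k m := fun k m => by fun_prop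
    exact isClosed_iInter fun k => isClosed_iInter fun m => IsClosed.inter
      (isClosed_iInter fun _ => (isClosed_isAdmissible N m).preimage (hcont k m))
      (isClosed_iInter fun _ => isClosed_singleton.preimage (hcont k m))
  · intro c hc k _ m _ j _ n _
    by_cases h : k ∈ Icc 2 K ∧ m ∈ Icc 2 (N - 1)
    · exact ((hc k m).1 h).mem_Icc_zero_one j n
    · rw [(hc k m).2 h]
      simp

lemma truncatedCoeffs_nonempty (N K : ℕ) : (truncatedCoeffs N K).Nonempty := by
  classical
  have h : ∀ m, ∃ c, m ∈ Icc 2 (N - 1) → IsAdmissible N m c := fun m => by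
    by_cases hm : m ∈ Icc 2 (N - 1)
    · have hm' := mem_Icc.1 hm
      obtain ⟨c, hc⟩ := exists_isAdmissible (N := N) (m := m) (by omega)
      exact ⟨c, fun _ => hc⟩
    · exact ⟨0, fun h => absurd h hm⟩
  choose c hc using h
  refine ⟨fun k m => if k ∈ Icc 2 K ∧ m ∈ Icc 2 (N - 1) then c m else 0, fun k m => ⟨fun h => ?_,
    fun h => if_neg h⟩⟩
  beta_reduce
  rw [if_pos h]
  exact hc m h.2

/-- Truncation does not alter the set of values, so the maximum over the compact truncated set is
the maximum over all admissible families. -/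
lemma isGreatest_underB {N K m : ℕ} (hm : m ∈ Icc 1 N) :
    IsGreatest ((fun c => tildeB N c K m) '' Coeffs N K) (underB N K m) := by
  classical
  have himage : (fun c => tildeB N c K m) '' truncatedCoeffs N K =
      (fun c => tildeB N c K m) '' Coeffs N K := by
    refine (Set.image_mono (truncatedCoeffs_subset N K)).antisymm ?_
    rintro _ ⟨c, hc, rfl⟩
    refine ⟨fun k m => if k ∈ Icc 2 K ∧ m ∈ Icc 2 (N - 1) then c k m else 0,
      fun k m => ⟨fun h => ?_, fun h => if_neg h⟩, ?_⟩
    · beta_reduce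
      rw [if_pos h]
      exact hc k h.1 m h.2
    · exact tildeB_congr (fun k hk m hm => if_pos ⟨hk, hm⟩) le_rfl hm
  obtain ⟨x, hx⟩ := ((isCompact_truncatedCoeffs N K).image
    (continuous_tildeB N K m)).exists_isGreatest ((truncatedCoeffs_nonempty N K).image _)
  rw [himage] at hx
  rwa [underB, hx.csSup_eq]

end
end PIR

theorem theorem1 (K N m : ℕ) (hK : 2 ≤ K) (hN : 2 ≤ N) (hm : m ∈ Finset.Icc 1 N) :
    PIR.underB N K m ≤ PIR.infoB N K m ∧
    PIR.underB N K m ≤ PIR.opB N K m ∧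
    IsGreatest ((fun c => PIR.tildeB N c K m) '' PIR.Coeffs N K) (PIR.underB N K m) ∧
    ∀ c ∈ PIR.Coeffs N K, PIR.tildeB N c K m ≤ PIR.underB N K m := by
  have hmax := PIR.isGreatest_underB (K := K) hm
  obtain ⟨c, hc, hcmax⟩ := hmax.1
  refine ⟨?_, ?_, hmax, fun c hc => hmax.2 ⟨c, hc, rfl⟩⟩
  · rw [← hcmax]
    exact PIR.tildeB_le_infoB hN (by omega) hc hm
  · rw [← hcmax]
    exact PIR.tildeB_le_opB hN (by omega) hc hm
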